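/- **Theorem.** Let $k$ be a field of characteristic zero and $n\ge 2$. Let $D_n$ be the Coxeter group of type $D$, that is, the group of permutations of $\{-n,\dots,-1,1,\dots,n\}$ generated by $S=\{s_{1'},s_1,\dots,s_{n-1}\}$, where $s_i=(-i-1,\,-i)(i,\,i+1)$ and $s_{1'}=(-2,1)(-1,2)$. For $J\subseteq S$ let $W_J$ be the subgroup generated by $J$, let $X_J$ be the set of minimal length representatives (length with respect to $S$) of the left cosets $wW_J$, and let $\mathcal X_J=\sum_{w\in X_J}w\in k[D_n]$. The descent algebra $\Sigma_{D_n}$ over $k$ is the subalgebra of $k[D_n]$ generated by the elements $\mathcal X_J$, $J\subseteq S$ (by a theorem of Solomon it is also their linear span). Let $\mathcal C(n)$ be the disjoint union of the sets $\mathcal C_{<n}$ of compositions of integers $m$ with $0\le m\le n-2$; $\mathcal C_1$ of compositions of $n$ with first component $1$; $\mathcal C_n$ of compositions of $n$ with first component at least $2$; and a second copy $\mathcal C_n'$ of $\mathcal C_n$. To $\kappa=[\kappa_1,\dots,\kappa_r]\in\mathcal C(n)$ associate the following subset $J(\kappa)$ of $S$: - $\{s_{\kappa_0},s_{\kappa_0+\kappa_1},\dots,s_{\kappa_0+\cdots+\kappa_{r-1}}\}$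 with $\kappa_0=n-m$, if $\kappa\in\mathcal C_{<n}$ is a composition of $m$ (the empty set if $m=0$); - $\{s_{1'},s_{\kappa_1},s_{\kappa_1+\kappa_2},\dots,s_{\kappa_1+\cdots+\kappa_{r-1}}\}$, if $\kappa\in\mathcal C_1$ or $\kappa\in\mathcal C_n$; - $\{s_1,s_{\kappa_1},s_{\kappa_1+\kappa_2},\dots,s_{\kappa_1+\cdots+\kappa_{r-1}}\}$, if $\kappa\in\mathcal C_n'$. Put $B_\kappa=\mathcal X_{S\setminus J(\kappa)}$. For $\kappa,\nu\in\mathcal C(n)$ write $\kappa\approx\nu$ if the components of $\kappa$ can be re-ordered to give the components of $\nu$, except that $\kappa\not\approx\nu$ when one of $\kappa,\nu$ lies in $\mathcal C_n$, the other lies in $\mathcal C_n'$, and all components are even. Then the (Jacobson) radical of $\Sigma_{D_n}$ is the $k$-linear span of all differences $B_\kappa-B_\nu$ with $\kappa,\nu\in\mathcal C(n)$ and $\kappa\approx\nu$. -/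

import Mathlib

/-! ### Descent algebras -/

/-- The length of `w` with respect to `S`: the least number of factors in an expression of `w`
as a product of elements of `S`. (It is only used for generating sets `S` of involutions, so
that every `w` has such an expression.) -/
noncomputable def wordLength {W : Type*} [Group W] (S : Set W) (w : W) : ℕ :=
  sInf {r : ℕ | ∃ l : List W, (∀ x ∈ l, x ∈ S) ∧ l.length = r ∧ l.prod = w}

/-- `X_J`: the elements `w` that have minimal length in their left coset `w W_J`, where `W_J` is
the subgroup generated by `J`. -/
def minCosetReps {W : Type*} [Group W] (S J : Set W) : Set W :=
  {w : W | ∀ u ∈ Subgroup.closure J, wordLength S w ≤ wordLength S (w * u)}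

/-- The formal sum of the elements of `X_J`, in the group algebra `k[W]`. -/
noncomputable def cosetSum (k : Type*) [Field k] {W : Type*} [Group W] [Finite W]
    (S J : Set W) : MonoidAlgebra k W :=
  ∑ w ∈ (Set.toFinite (minCosetReps S J)).toFinset, MonoidAlgebra.of k W w

/-- The descent algebra of `(W, S)` over `k`: the subalgebra of the group algebra generated by the
sums of `X_J`, for `J ⊆ S`. For a finite Coxeter group the linear span of these sums is closed
under multiplication, by a theorem of Solomon, so this subalgebra is that span. -/
noncomputable def descentAlgebra (k : Type*) [Field k] {W : Type*} [Group W] [Finite W]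
    (S : Set W) : Subalgebra k (MonoidAlgebra k W) :=
  Algebra.adjoin k {x | ∃ J : Set W, J ⊆ S ∧ x = cosetSum k S J}

/-- The sum of the elements of `X_J` as an element of the descent algebra. -/
noncomputable def descentElt (k : Type*) [Field k] {W : Type*} [Group W] [Finite W]
    (S J : Set W) (hJ : J ⊆ S) : descentAlgebra k S :=
  ⟨cosetSum k S J, Algebra.subset_adjoin ⟨J, hJ, rfl⟩⟩

/-! ### The Coxeter group of type `D` -/

/-- The set `{-n, …, -1, 1, …, n}`. -/
abbrev SignedPoint (n : ℕ) : Type := {i : ℤ // i ≠ 0 ∧ -(n : ℤ) ≤ i ∧ i ≤ (n : ℤ)}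

instance SignedPoint.instFinite (n : ℕ) : Finite (SignedPoint n) :=
  Set.Finite.to_subtype
    ((Set.finite_Icc (-(n : ℤ)) (n : ℤ)).subset fun _ h => ⟨h.2.1, h.2.2⟩)

/-- The permutation `s_{1'} = (-2, 1)(-1, 2)`. -/
def permOnePrime (n : ℕ) [hn : n.AtLeastTwo] : Equiv.Perm (SignedPoint n) :=
  Equiv.swap ⟨-2, by have := hn.prop; omega⟩ ⟨1, by have := hn.prop; omega⟩ *
    Equiv.swap ⟨-1, by have := hn.prop; omega⟩ ⟨2, by have := hn.prop; omega⟩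

/-- The permutation `s_i = (-i-1, -i)(i, i+1)`, for `1 ≤ i ≤ n - 1`. -/
def permS (n i : ℕ) (h₁ : 1 ≤ i) (h₂ : i < n) : Equiv.Perm (SignedPoint n) :=
  Equiv.swap ⟨-(i : ℤ) - 1, by omega⟩ ⟨-(i : ℤ), by omega⟩ *
    Equiv.swap ⟨(i : ℤ), by omega⟩ ⟨(i : ℤ) + 1, by omega⟩

/-- The `n` generators, indexed by `Fin n`: the index `0` stands for the label `1'`, and the index
`i` with `1 ≤ i ≤ n - 1` for the label `i`. -/
def permGen (n : ℕ) [n.AtLeastTwo] (i : Fin n) : Equiv.Perm (SignedPoint n) :=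
  if h : (i : ℕ) = 0 then permOnePrime n else permS n i (Nat.one_le_iff_ne_zero.mpr h) i.isLt

/-- The Coxeter group `D_n`, as the group of permutations of `{-n, …, -1, 1, …, n}` generated by
`s_{1'}, s_1, …, s_{n-1}`. -/
abbrev DGroup (n : ℕ) [n.AtLeastTwo] : Subgroup (Equiv.Perm (SignedPoint n)) :=
  Subgroup.closure (Set.range (permGen n))

/-- The generators as elements of `D_n`. -/
def gen (n : ℕ) [n.AtLeastTwo] (i : Fin n) : DGroup n :=
  ⟨permGen n i, Subgroup.subset_closure (Set.mem_range_self i)⟩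

/-- The generating set `S` of `D_n`. -/
def genSet (n : ℕ) [n.AtLeastTwo] : Set (DGroup n) := Set.range (gen n)

/-- The descent algebra of `D_n` over `k`. -/
noncomputable abbrev SigmaD (k : Type*) [Field k] (n : ℕ) [n.AtLeastTwo] :
    Subalgebra k (MonoidAlgebra k (DGroup n)) :=
  descentAlgebra k (genSet n)

/-! ### The compositions that label subsets of `S` -/

/-- The labels `C(n)`, the disjoint union of
* `C_{<n}`: the compositions of some `m ≤ n - 2`,
* `C_1`: the compositions of `n` with first component `1`,
* `C_n`: the compositions of `n` with first component at least `2`,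
* `C_n'`: a second copy of `C_n`. -/
inductive DComp (n : ℕ) : Type
  | below (m : ℕ) (hm : m + 2 ≤ n) (c : Composition m) : DComp n
  | one (c : Composition n) (hc : c.blocks.head? = some 1) : DComp n
  | full (c : Composition n) (hc : ∃ a, 2 ≤ a ∧ c.blocks.head? = some a) : DComp n
  | fullPrime (c : Composition n) (hc : ∃ a, 2 ≤ a ∧ c.blocks.head? = some a) : DComp n

namespace DComp

/-- The list of components. -/
def components {n : ℕ} : DComp n → List ℕ
  | below _ _ c => c.blocks
  | one c _ => c.blocks
  | full c _ => c.blocks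
  | fullPrime c _ => c.blocks

/-- Membership in `C_n`. -/
def InFull {n : ℕ} : DComp n → Prop
  | full _ _ => True
  | _ => False

/-- Membership in `C_n'`. -/
def InFullPrime {n : ℕ} : DComp n → Prop
  | fullPrime _ _ => True
  | _ => False

/-- The indices (in the convention of `permGen`, where `0` stands for `1'`) of the generators in
the subset corresponding to a label. Here `c.sizeUpTo j` is the sum of the first `j`
components. -/
def indexSet {n : ℕ} : DComp n → Set (Fin n)
  | below m _ c => {i | ∃ j < c.length, (i : ℕ) = (n - m) + c.sizeUpTo j}
  | one c _ => {i | (i : ℕ) = 0 ∨ ∃ j, 1 ≤ j ∧ j < c.length ∧ (i : ℕ) = c.sizeUpTo j}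
  | full c _ => {i | (i : ℕ) = 0 ∨ ∃ j, 1 ≤ j ∧ j < c.length ∧ (i : ℕ) = c.sizeUpTo j}
  | fullPrime c _ => {i | (i : ℕ) = 1 ∨ ∃ j, 1 ≤ j ∧ j < c.length ∧ (i : ℕ) = c.sizeUpTo j}

/-- The subset `J` of `S` corresponding to a label. -/
def subsetOf {n : ℕ} [n.AtLeastTwo] (κ : DComp n) : Set (DGroup n) :=
  gen n '' κ.indexSet

/-- The relation `κ ≈ ν`: the components agree up to order, except that an element of `C_n` and
an element of `C_n'` are not related if all components are even. -/
def Equivalent {n : ℕ} (κ ν : DComp n) : Prop :=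
  κ.components.Perm ν.components ∧
    ¬ (κ.InFull ∧ ν.InFullPrime ∧ ∀ a ∈ κ.components, Even a) ∧
    ¬ (κ.InFullPrime ∧ ν.InFull ∧ ∀ a ∈ κ.components, Even a)

end DComp

/-- `B_κ`: the sum of `X_{S \ J}`, where `J ⊆ S` corresponds to `κ`. -/
noncomputable def basisB (k : Type*) [Field k] {n : ℕ} [n.AtLeastTwo] (κ : DComp n) :
    SigmaD k n :=
  descentElt k (genSet n) (genSet n \ κ.subsetOf) Set.sdiff_subset

/-!
The faces of the reflection arrangement form a semigroup under the Tits product, on which the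
Coxeter group `W` acts. The sum of the translates of a face, each mapped to the element of `W`
whose chamber is its product with the fundamental chamber, is a multiple of `X_J`, where `J`
consists of the simple roots that vanish on the face. Products of such orbit sums are therefore
combinations of orbit sums, which is Solomon's theorem, and the product of `X_K` and `X_J` is a
multiple of `X_J` up to terms of faces on which fewer roots vanish. The coefficient counts
translates of the flat of `K` inside the flat of `J`. Hence `X_K` acts on the associated graded
module by scalars, which depend only on the conjugacy class of the flat of `K` and separate these
classes by triangularity. The radical is the common kernel of these scalars, so it is spanned by
the differences `X_K - X_J` with conjugate flats.

In type `D`, a flat identifies coordinates up to sign, or sets them to zero. Signed permutations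
conjugate two flats if and only if the block sizes agree. One may correct such a permutation by
changing the signs of a block of odd size or of a vanishing coordinate to land in `D_n`, so the
parity of the number of sign changes is an obstruction only if no coordinate vanishes and all
blocks are even.
-/

/-! ### Algebras with triangular left multiplication -/

section TriangularMul

variable {k A ι : Type*} [Field k] [Ring A] [Algebra k A]

/-- The filtration of `A` by the rank `r` of the elements `b i`: its `m`-th step is spanned by the
`b i` of rank less than `m`. -/
def rankSpan (k : Type*) [Field k] {A ι : Type*} [AddCommGroup A] [Module k A] (b : ι → A)
    (r : ι → ℕ) (m : ℕ) : Submodule k A :=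
  Submodule.span k (b '' {i | r i < m})

/-- Left multiplication by every `b i` is triangular with respect to the rank `r`, and the
coefficient of `b j` in `b i * b j` is `c i j`. -/
def IsTriangularMul (b : ι → A) (r : ι → ℕ) (c : ι → ι → k) : Prop :=
  ∀ i j, b i * b j - c i j • b j ∈ rankSpan k b r (r j)

/-- The linear extension of `i ↦ c i j`; for triangular left multiplication this is the character
of `A` by which it acts on the class of `b j` in the graded module of the rank filtration. -/
noncomputable def diagCoeff (b : Module.Basis ι k A) (c : ι → ι → k) (j : ι) : A →ₗ[k] k :=
  b.constr k fun i => c i j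

theorem diagCoeff_basis (b : Module.Basis ι k A) (c : ι → ι → k) (i j : ι) :
    diagCoeff b c j (b i) = c i j :=
  b.constr_basis k _ i

theorem rankSpan_mono (b : ι → A) (r : ι → ℕ) : Monotone (rankSpan k b r) := fun _ _ h =>
  Submodule.span_mono (Set.image_mono fun _ hi => lt_of_lt_of_le hi h)

theorem rankSpan_zero (b : ι → A) (r : ι → ℕ) : rankSpan k b r 0 = ⊥ := by
  simp [rankSpan]

theorem exists_rankSpan_eq_top [Finite ι] (b : Module.Basis ι k A) (r : ι → ℕ) :
    ∃ m, rankSpan k b r m = ⊤ := by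
  obtain ⟨m, hm⟩ := (Set.finite_range r).bddAbove
  refine ⟨m + 1, ?_⟩
  rw [rankSpan, ← b.span_eq, ← Set.image_univ]
  congr 2
  ext j
  simpa using Nat.lt_succ_of_le (hm ⟨j, rfl⟩)

theorem basis_notMem_rankSpan (b : Module.Basis ι k A) (r : ι → ℕ) (j : ι) :
    b j ∉ rankSpan k b r (r j) :=
  b.linearIndependent.notMem_span_image (by simp)

theorem mul_mem_of_forall_mul_basis_mem {b : ι → A} {r : ι → ℕ} {m : ℕ} {N : Submodule k A}
    {a x : A} (h : ∀ j, r j < m → a * b j ∈ N) (hx : x ∈ rankSpan k b r m) : a * x ∈ N := by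
  have hle : rankSpan k b r m ≤ N.comap (LinearMap.mulLeft k a) :=
    Submodule.span_le.2 (by rintro _ ⟨j, hj, rfl⟩; exact h j hj)
  exact hle hx

namespace IsTriangularMul

variable {b : Module.Basis ι k A} {r : ι → ℕ} {c : ι → ι → k} {a : A} {j : ι}

theorem mul_basis_sub_mem (hb : IsTriangularMul b r c) (a : A) (j : ι) :
    a * b j - diagCoeff b c j a • b j ∈ rankSpan k b r (r j) := by
  have hle : ⊤ ≤ (rankSpan k b r (r j)).comap
      (LinearMap.mulRight k (b j) - (diagCoeff b c j).smulRight (b j)) := by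
    rw [← b.span_eq, Submodule.span_le]
    rintro _ ⟨i, rfl⟩
    simpa [diagCoeff_basis] using hb i j
  exact hle (Submodule.mem_top (x := a))

theorem mul_mem_rankSpan (hb : IsTriangularMul b r c) (a : A) {x : A} {m : ℕ}
    (hx : x ∈ rankSpan k b r m) : a * x ∈ rankSpan k b r m := by
  refine mul_mem_of_forall_mul_basis_mem (fun j hj => ?_) hx
  have hbj : b j ∈ rankSpan k b r m := Submodule.subset_span ⟨j, hj, rfl⟩
  rw [← sub_add_cancel (a * b j) (diagCoeff b c j a • b j)]
  exact add_mem (rankSpan_mono b r hj.le (hb.mul_basis_sub_mem a j)) (Submodule.smul_mem _ _ hbj)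

theorem diagCoeff_eq_zero_iff (hb : IsTriangularMul b r c) :
    diagCoeff b c j a = 0 ↔ a * b j ∈ rankSpan k b r (r j) := by
  have hsub := hb.mul_basis_sub_mem a j
  refine ⟨fun h => by simpa [h] using hsub, fun h => ?_⟩
  by_contra hne
  rw [Submodule.sub_mem_iff_right _ h, Submodule.smul_mem_iff _ hne] at hsub
  exact basis_notMem_rankSpan b r j hsub

theorem isNilpotent_of_diagCoeff_eq_zero [Finite ι] (hb : IsTriangularMul b r c)
    (ha : ∀ j, diagCoeff b c j a = 0) : IsNilpotent a := by
  have lowers_rank (m : ℕ) (x : A) (hx : x ∈ rankSpan k b r (m + 1)) :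
      a * x ∈ rankSpan k b r m :=
    mul_mem_of_forall_mul_basis_mem (fun j hj =>
      rankSpan_mono b r (Nat.lt_succ_iff.1 hj) (hb.diagCoeff_eq_zero_iff.1 (ha j))) hx
  have pow_kills (m : ℕ) : ∀ x ∈ rankSpan k b r m, a ^ m * x = 0 := by
    induction m with
    | zero =>
      intro x hx
      rw [rankSpan_zero, Submodule.mem_bot] at hx
      rw [hx, mul_zero]
    | succ m ih =>
      intro x hx
      rw [pow_succ, mul_assoc]
      exact ih _ (lowers_rank m x hx)
  obtain ⟨m, hm⟩ := exists_rankSpan_eq_top b r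
  exact ⟨m, by simpa using pow_kills m 1 (hm ▸ Submodule.mem_top)⟩

theorem diagCoeff_eq_zero_of_mem_jacobson (hb : IsTriangularMul b r c)
    (ha : a ∈ Ring.jacobson A) (j : ι) : diagCoeff b c j a = 0 := by
  set t := diagCoeff b c j a with ht
  by_contra hne
  rw [← Ideal.jacobson_bot, Ideal.mem_jacobson_iff] at ha
  obtain ⟨z, hz⟩ := ha (algebraMap k A (-t⁻¹))
  have hz_inv : z * (1 - t⁻¹ • a) = 1 := by
    rw [Ideal.mem_bot, sub_eq_zero, mul_assoc, ← Algebra.smul_def, neg_smul, mul_neg] at hz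
    rw [mul_sub, mul_one, sub_eq_neg_add]
    exact hz
  have hmem : (1 - t⁻¹ • a) * b j ∈ rankSpan k b r (r j) := by
    convert Submodule.smul_mem _ (-t⁻¹) (hb.mul_basis_sub_mem a j) using 1
    rw [smul_sub, smul_smul, ← ht, neg_mul, inv_mul_cancel₀ hne, sub_mul, one_mul,
      smul_mul_assoc, neg_smul, neg_smul, one_smul]
    abel
  have := hb.mul_mem_rankSpan z hmem
  rw [← mul_assoc, hz_inv, one_mul] at this
  exact basis_notMem_rankSpan b r j this

theorem mem_jacobson_iff [Finite ι] (hb : IsTriangularMul b r c) :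
    a ∈ Ring.jacobson A ↔ ∀ j, diagCoeff b c j a = 0 := by
  refine ⟨hb.diagCoeff_eq_zero_of_mem_jacobson, fun h => ?_⟩
  rw [← Ideal.jacobson_bot, Ideal.mem_jacobson_iff]
  intro y
  have hnil : IsNilpotent (y * a) := by
    refine hb.isNilpotent_of_diagCoeff_eq_zero fun j => hb.diagCoeff_eq_zero_iff.2 ?_
    rw [mul_assoc]
    exact hb.mul_mem_rankSpan y (hb.diagCoeff_eq_zero_iff.1 (h j))
  obtain ⟨u, hu⟩ := hnil.isUnit_add_one
  refine ⟨(u⁻¹ : Aˣ), ?_⟩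
  rw [Ideal.mem_bot, sub_eq_zero, ← Units.inv_mul u, hu, mul_add, mul_one, mul_assoc]

end IsTriangularMul

theorem eq_zero_of_triangular_sum_eq_zero [Fintype ι] {r : ι → ℕ} {c : ι → ι → k} {x : ι → k}
    (hsum : ∀ j, ∑ i, x i * c i j = 0)
    (hdiag : ∀ i, c i i ≠ 0)
    (htri : ∀ i j, x i ≠ 0 → x j ≠ 0 → c i j ≠ 0 → r i ≤ r j → i = j) : x = 0 := by
  classical
  by_contra hne
  obtain ⟨i₀, hi₀⟩ := Function.ne_iff.1 hne
  obtain ⟨j, hj, hmax⟩ := Finset.exists_max_image (Finset.univ.filter fun i => x i ≠ 0) r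
    ⟨i₀, by simpa using hi₀⟩
  have hxj : x j ≠ 0 := (Finset.mem_filter.1 hj).2
  have hsingle := hsum j
  rw [Finset.sum_eq_single j ?_ (by simp)] at hsingle
  · exact mul_ne_zero hxj (hdiag j) hsingle
  · intro i _ hij
    by_contra hprod
    have hxi := left_ne_zero_of_mul hprod
    exact hij (htri i j hxi hxj (right_ne_zero_of_mul hprod) (hmax i (by simpa using hxi)))

theorem sub_sum_repr_smul_mem_span_sub [Fintype ι] (b : Module.Basis ι k A) {s : ι → ι → Prop}
    {f : ι → ι} (hf : ∀ i, s i (f i)) (a : A) :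
    a - ∑ i, b.repr a i • b (f i) ∈ Submodule.span k {x | ∃ i j, s i j ∧ x = b i - b j} := by
  have : a - ∑ i, b.repr a i • b (f i) = ∑ i, b.repr a i • (b i - b (f i)) := by
    simp only [smul_sub, Finset.sum_sub_distrib, b.sum_repr]
  rw [this]
  exact Submodule.sum_mem _ fun i _ =>
    Submodule.smul_mem _ _ (Submodule.subset_span ⟨i, f i, hf i, rfl⟩)

theorem diagCoeff_eq_zero_of_mem_span_sub {b : Module.Basis ι k A}
    {c : ι → ι → k} {s : ι → ι → Prop} (hc : ∀ i i' j, s i i' → c i j = c i' j) {x : A}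
    (hx : x ∈ Submodule.span k {x | ∃ i j, s i j ∧ x = b i - b j}) (j : ι) :
    diagCoeff b c j x = 0 := by
  suffices h : Submodule.span k {x | ∃ i j, s i j ∧ x = b i - b j} ≤
    LinearMap.ker (diagCoeff b c j) from h hx
  rw [Submodule.span_le]
  rintro _ ⟨i, i', hii', rfl⟩
  simp [diagCoeff_basis, hc i i' j hii']

theorem IsTriangularMul.jacobson_eq_span_sub [Finite ι] {b : Module.Basis ι k A} {r : ι → ℕ}
    {c : ι → ι → k} (hb : IsTriangularMul b r c) (s : Setoid ι)
    (hc : ∀ i i' j, s i i' → c i j = c i' j) (hdiag : ∀ i, c i i ≠ 0)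
    (htri : ∀ i j, c i j ≠ 0 → r i ≤ r j → s i j) :
    (Ring.jacobson A).restrictScalars k =
      Submodule.span k {x | ∃ i j, s i j ∧ x = b i - b j} := by
  classical
  have := Fintype.ofFinite ι
  ext a
  rw [Submodule.restrictScalars_mem, hb.mem_jacobson_iff]
  refine ⟨fun ha => ?_, diagCoeff_eq_zero_of_mem_span_sub hc⟩
  let rep (i : ι) : ι := (Quotient.mk s i).out
  have rel_rep (i : ι) : s i (rep i) := s.symm (Quotient.exact (Quotient.out_eq _))
  have rep_eq {i j : ι} (h : s i j) : rep i = rep j := congrArg Quotient.out (Quotient.sound h)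
  let x (t : ι) : k := ∑ i with rep i = t, b.repr a i
  have rep_of_ne {t : ι} (ht : x t ≠ 0) : rep t = t := by
    obtain ⟨i, hi, -⟩ := Finset.exists_ne_zero_of_sum_ne_zero ht
    rw [← (Finset.mem_filter.1 hi).2]
    exact (rep_eq (rel_rep i)).symm
  have sum_rep : ∑ i, b.repr a i • b (rep i) = ∑ t, x t • b t := by
    rw [← Finset.sum_fiberwise Finset.univ rep]
    refine Finset.sum_congr rfl fun t _ => ?_
    rw [Finset.sum_smul]
    exact Finset.sum_congr rfl fun i hi => by rw [(Finset.mem_filter.1 hi).2]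
  have sub_mem := sub_sum_repr_smul_mem_span_sub b rel_rep a
  rw [sum_rep] at sub_mem
  have x_eq_zero : x = 0 := by
    refine eq_zero_of_triangular_sum_eq_zero (r := r) (c := c) (fun j => ?_) hdiag
      fun i j hi hj hij hr => ?_
    · simpa [ha j, diagCoeff_basis] using diagCoeff_eq_zero_of_mem_span_sub hc sub_mem j
    · rw [← rep_of_ne hi, ← rep_of_ne hj, rep_eq (htri i j hij hr)]
  simpa [x_eq_zero] using sub_mem

end TriangularMul

/-! ### Simple systems, and the faces of their arrangements -/

section SimpleSystem

/-- A crystallographic simple system for a group `W` acting on a lattice `V`: the data by which the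
combinatorics of the reflection arrangement of a finite Weyl group is controlled. Roots are
integral functionals on `V`, and `DomMulAct.mk g • α` is the functional `v ↦ α (g • v)`. The vectors
`weight i` are positive multiples of the fundamental weights. -/
structure SimpleSystem (W V ι : Type*) [Group W] [AddCommGroup V] [DistribMulAction W V] where
  posRoots : Finset (V →+ ℤ)
  simpleRoot : ι → V →+ ℤ
  reflection : ι → W
  weight : ι → V
  zero_notMem : 0 ∉ posRoots
  simpleRoot_mem : ∀ i, simpleRoot i ∈ posRoots
  mem_closure_simpleRoot : ∀ α ∈ posRoots, α ∈ AddSubmonoid.closure (Set.range simpleRoot)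
  simpleRoot_weight_self : ∀ i, 0 < simpleRoot i (weight i)
  simpleRoot_weight_of_ne : ∀ i j, i ≠ j → simpleRoot i (weight j) = 0
  reflection_mul_self : ∀ i, reflection i * reflection i = 1
  reflection_smul_simpleRoot : ∀ i, DomMulAct.mk (reflection i) • simpleRoot i = -simpleRoot i
  reflection_smul_mem : ∀ i, ∀ α ∈ posRoots, α ≠ simpleRoot i →
    DomMulAct.mk (reflection i) • α ∈ posRoots
  reflection_smul_eq_self : ∀ i, ∀ v : V, simpleRoot i v = 0 → reflection i • v = v
  closure_reflection : Subgroup.closure (Set.range reflection) = ⊤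
  eq_one_of_smul_mem : ∀ g : W, (∀ α ∈ posRoots, DomMulAct.mk g • α ∈ posRoots) → g = 1

namespace SimpleSystem

variable {W V ι : Type*} [Group W] [AddCommGroup V] [DistribMulAction W V]
  (Φ : SimpleSystem W V ι)

open Classical in
/-- The root system: the positive roots and their negatives. -/
noncomputable def roots : Finset (V →+ ℤ) := Φ.posRoots ∪ Φ.posRoots.image Neg.neg

/-- The vector lies in the closed fundamental chamber. -/
def IsDominant (v : V) : Prop := ∀ α ∈ Φ.posRoots, 0 ≤ α v

/-- The vector lies in the open fundamental chamber. -/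
def IsStrictDominant (v : V) : Prop := ∀ α ∈ Φ.posRoots, 0 < α v

/-- The positive roots that are negative on a vector. -/
noncomputable def inversions (v : V) : Finset (V →+ ℤ) := Φ.posRoots.filter fun α => α v < 0

/-- The indices of the simple roots that vanish on a vector. -/
def simpleZeros (v : V) : Set ι := {i | Φ.simpleRoot i v = 0}

/-- The roots that vanish on a vector. They determine the flat of the arrangement that is spanned
by the face of the vector. -/
noncomputable def zeroSet (v : V) : Finset (V →+ ℤ) := Φ.roots.filter fun α => α v = 0

/-- The vectors lie in the same face of the arrangement. -/
def SameFace (v u : V) : Prop := ∀ α ∈ Φ.roots, 0 < α v ↔ 0 < α u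

/-- A vector close to `v` in the direction of `u`, up to scaling: it represents the product, in the
face semigroup of the arrangement, of the faces of `v` and of `u`. -/
noncomputable def faceMul (v u : V) : V := (1 + ∑ α ∈ Φ.roots, |α u|) • v + u

variable {Φ} {v u w : V} {α : V →+ ℤ} {i : ι}

theorem mem_roots : α ∈ Φ.roots ↔ α ∈ Φ.posRoots ∨ -α ∈ Φ.posRoots := by
  classical
  rw [roots, Finset.mem_union, Finset.mem_image]
  exact or_congr_right ⟨fun ⟨β, hβ, h⟩ => by rwa [← h, neg_neg], fun h => ⟨_, h, neg_neg α⟩⟩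

theorem neg_mem_roots : -α ∈ Φ.roots ↔ α ∈ Φ.roots := by
  rw [mem_roots, mem_roots, neg_neg, or_comm]

theorem posRoots_subset_roots : Φ.posRoots ⊆ Φ.roots := fun _ hα => mem_roots.2 (Or.inl hα)

variable (Φ) in
theorem simpleRoot_mem_roots (i : ι) : Φ.simpleRoot i ∈ Φ.roots :=
  posRoots_subset_roots (Φ.simpleRoot_mem i)

theorem mem_zeroSet : α ∈ Φ.zeroSet v ↔ α ∈ Φ.roots ∧ α v = 0 := Finset.mem_filter

theorem mem_inversions : α ∈ Φ.inversions v ↔ α ∈ Φ.posRoots ∧ α v < 0 := Finset.mem_filter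

theorem mem_posRoots_of_pos (hα : α ∈ Φ.roots) (hv : Φ.IsDominant v) (h : 0 < α v) :
    α ∈ Φ.posRoots :=
  (mem_roots.1 hα).resolve_right fun hneg => absurd (hv _ hneg) (by simpa using h)

theorem isDominant_iff_simpleRoot : Φ.IsDominant v ↔ ∀ i, 0 ≤ Φ.simpleRoot i v := by
  refine ⟨fun h i => h _ (Φ.simpleRoot_mem i), fun h α hα => ?_⟩
  replace hα := Φ.mem_closure_simpleRoot α hα
  induction hα using AddSubmonoid.closure_induction with
  | mem _ hi => obtain ⟨i, rfl⟩ := hi; exact h i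
  | zero => exact le_rfl
  | add α β _ _ ihα ihβ => exact add_nonneg ihα ihβ

theorem isStrictDominant_iff_simpleRoot : Φ.IsStrictDominant v ↔ ∀ i, 0 < Φ.simpleRoot i v := by
  refine ⟨fun h i => h _ (Φ.simpleRoot_mem i), fun h α hα => ?_⟩
  suffices α = 0 ∨ 0 < α v from this.resolve_left fun h0 => Φ.zero_notMem (h0 ▸ hα)
  replace hα := Φ.mem_closure_simpleRoot α hα
  induction hα using AddSubmonoid.closure_induction with
  | mem _ hi => obtain ⟨i, rfl⟩ := hi; exact Or.inr (h i)
  | zero => exact Or.inl rfl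
  | add α β _ _ ihα ihβ =>
    rcases ihα with rfl | ihα <;> rcases ihβ with rfl | ihβ
    · simp
    · simp [ihβ]
    · simp [ihα]
    · exact Or.inr (add_pos ihα ihβ)

theorem IsStrictDominant.isDominant (hv : Φ.IsStrictDominant v) : Φ.IsDominant v :=
  fun α hα => (hv α hα).le

theorem exists_simpleRoot_neg (h : ¬ Φ.IsDominant v) : ∃ i, Φ.simpleRoot i v < 0 := by
  simpa [isDominant_iff_simpleRoot] using h

theorem inversions_eq_empty_iff : Φ.inversions v = ∅ ↔ Φ.IsDominant v := by
  simp [inversions, Finset.filter_eq_empty_iff, IsDominant]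

theorem apply_eq_zero_of_simpleZeros_subset (hv : Φ.IsDominant v)
    (h : Φ.simpleZeros v ⊆ Φ.simpleZeros u) (hα : α ∈ Φ.posRoots) (hαv : α v = 0) : α u = 0 := by
  suffices 0 ≤ α v ∧ (α v = 0 → α u = 0) from this.2 hαv
  clear hαv
  replace hα := Φ.mem_closure_simpleRoot α hα
  induction hα using AddSubmonoid.closure_induction with
  | mem _ hi =>
    obtain ⟨i, rfl⟩ := hi
    exact ⟨hv _ (Φ.simpleRoot_mem i), fun h0 => h h0⟩
  | zero => simp
  | add α β _ _ ihα ihβ =>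
    refine ⟨add_nonneg ihα.1 ihβ.1, fun h0 => ?_⟩
    obtain ⟨hα0, hβ0⟩ := (add_eq_zero_iff_of_nonneg ihα.1 ihβ.1).1 h0
    simp [ihα.2 hα0, ihβ.2 hβ0]

theorem zeroSet_subset_of_simpleZeros_subset (hv : Φ.IsDominant v)
    (h : Φ.simpleZeros v ⊆ Φ.simpleZeros u) : Φ.zeroSet v ⊆ Φ.zeroSet u := by
  intro α hα
  obtain ⟨hα, hαv⟩ := mem_zeroSet.1 hα
  refine mem_zeroSet.2 ⟨hα, ?_⟩
  rcases mem_roots.1 hα with hpos | hneg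
  · exact apply_eq_zero_of_simpleZeros_subset hv h hpos hαv
  · simpa using apply_eq_zero_of_simpleZeros_subset hv h hneg (by simpa using hαv)

theorem zeroSet_eq_of_simpleZeros_eq (hv : Φ.IsDominant v) (hu : Φ.IsDominant u)
    (h : Φ.simpleZeros v = Φ.simpleZeros u) : Φ.zeroSet v = Φ.zeroSet u :=
  subset_antisymm (zeroSet_subset_of_simpleZeros_subset hv h.subset)
    (zeroSet_subset_of_simpleZeros_subset hu h.superset)

/-! ### The product of faces -/

theorem faceMul_pos_of_pos (hα : α ∈ Φ.roots) (h : 0 < α v) : 0 < α (Φ.faceMul v u) := by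
  have hle : |α u| ≤ ∑ β ∈ Φ.roots, |β u| :=
    Finset.single_le_sum (f := fun β : V →+ ℤ => |β u|) (fun β _ => abs_nonneg (β u)) hα
  have hmul := mul_le_mul_of_nonneg_left (Int.add_one_le_iff.2 h)
    (add_nonneg zero_le_one ((abs_nonneg (α u)).trans hle))
  simp only [faceMul, map_add, map_zsmul, smul_eq_mul]
  linarith [neg_abs_le (α u)]

theorem faceMul_pos_iff (hα : α ∈ Φ.roots) :
    0 < α (Φ.faceMul v u) ↔ 0 < α v ∨ α v = 0 ∧ 0 < α u := by
  rcases lt_trichotomy (α v) 0 with h | h | h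
  · have hneg := faceMul_pos_of_pos (u := u) (neg_mem_roots.2 hα) (by simpa using h)
    rw [AddMonoidHom.neg_apply, neg_pos] at hneg
    simp [h.not_gt, h.ne, hneg.le]
  · simp [faceMul, h]
  · simp [h, faceMul_pos_of_pos hα h]

theorem eq_zero_iff_not_pos : α v = 0 ↔ ¬ 0 < α v ∧ ¬ 0 < (-α) v := by
  rw [AddMonoidHom.neg_apply]
  omega

theorem faceMul_eq_zero_iff (hα : α ∈ Φ.roots) : α (Φ.faceMul v u) = 0 ↔ α v = 0 ∧ α u = 0 := by
  rw [eq_zero_iff_not_pos, faceMul_pos_iff hα, faceMul_pos_iff (neg_mem_roots.2 hα)]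
  simp only [AddMonoidHom.neg_apply]
  omega

theorem SameFace.refl (v : V) : Φ.SameFace v v := fun _ _ => Iff.rfl

theorem SameFace.symm (h : Φ.SameFace v u) : Φ.SameFace u v := fun α hα => (h α hα).symm

theorem SameFace.trans (h : Φ.SameFace v u) (h' : Φ.SameFace u w) : Φ.SameFace v w :=
  fun α hα => (h α hα).trans (h' α hα)

theorem SameFace.eq_zero_iff (h : Φ.SameFace v u) (hα : α ∈ Φ.roots) : α v = 0 ↔ α u = 0 := by
  rw [eq_zero_iff_not_pos, h α hα, h _ (neg_mem_roots.2 hα), ← eq_zero_iff_not_pos]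

theorem SameFace.faceMul {v' u' : V} (h : Φ.SameFace v v') (h' : Φ.SameFace u u') :
    Φ.SameFace (Φ.faceMul v u) (Φ.faceMul v' u') := fun α hα => by
  rw [faceMul_pos_iff hα, faceMul_pos_iff hα, h α hα, h' α hα, h.eq_zero_iff hα]

theorem sameFace_faceMul_assoc (v u w : V) :
    Φ.SameFace (Φ.faceMul (Φ.faceMul v u) w) (Φ.faceMul v (Φ.faceMul u w)) := fun α hα => by
  simp only [faceMul_pos_iff hα, faceMul_eq_zero_iff hα]
  tauto

theorem IsStrictDominant.of_sameFace (hv : Φ.IsStrictDominant v) (h : Φ.SameFace v u) :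
    Φ.IsStrictDominant u :=
  fun α hα => (h α (posRoots_subset_roots hα)).1 (hv α hα)

theorem IsStrictDominant.sameFace (hv : Φ.IsStrictDominant v) (hu : Φ.IsStrictDominant u) :
    Φ.SameFace v u := fun α hα =>
  ⟨fun h => hu α (mem_posRoots_of_pos hα hv.isDominant h),
    fun h => hv α (mem_posRoots_of_pos hα hu.isDominant h)⟩

theorem isStrictDominant_faceMul (hv : Φ.IsDominant v)
    (hu : ∀ i ∈ Φ.simpleZeros v, 0 < Φ.simpleRoot i u) : Φ.IsStrictDominant (Φ.faceMul v u) := by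
  refine isStrictDominant_iff_simpleRoot.2 fun i =>
    (faceMul_pos_iff (Φ.simpleRoot_mem_roots i)).2 ?_
  rcases (hv _ (Φ.simpleRoot_mem i)).lt_or_eq' with h | h
  · exact Or.inl h
  · exact Or.inr ⟨h, hu i h⟩

theorem IsDominant.of_faceMul (h : Φ.IsStrictDominant (Φ.faceMul v u)) : Φ.IsDominant v := by
  intro α hα
  rcases (faceMul_pos_iff (posRoots_subset_roots hα)).1 (h α hα) with hpos | ⟨hzero, -⟩
  · exact hpos.le
  · exact hzero.ge

theorem zeroSet_faceMul_subset (v u : V) : Φ.zeroSet (Φ.faceMul v u) ⊆ Φ.zeroSet v := fun _ hα =>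
  mem_zeroSet.2 ⟨(mem_zeroSet.1 hα).1,
    ((faceMul_eq_zero_iff (mem_zeroSet.1 hα).1).1 (mem_zeroSet.1 hα).2).1⟩

theorem sameFace_faceMul_of_zeroSet_subset (h : Φ.zeroSet v ⊆ Φ.zeroSet u) :
    Φ.SameFace (Φ.faceMul v u) v := fun α hα => by
  rw [faceMul_pos_iff hα, or_iff_left]
  rintro ⟨hzero, hpos⟩
  exact hpos.ne' (mem_zeroSet.1 (h (mem_zeroSet.2 ⟨hα, hzero⟩))).2

theorem card_zeroSet_faceMul_lt (h : ¬ Φ.zeroSet v ⊆ Φ.zeroSet u) :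
    (Φ.zeroSet (Φ.faceMul v u)).card < (Φ.zeroSet v).card := by
  refine Finset.card_lt_card ((zeroSet_faceMul_subset v u).ssubset_of_ne fun heq => h ?_)
  intro α hα
  rw [← heq, mem_zeroSet] at hα
  exact mem_zeroSet.2 ⟨hα.1, ((faceMul_eq_zero_iff hα.1).1 hα.2).2⟩

variable (Φ) in
theorem reflection_smul_reflection_smul (i : ι) (v : V) :
    Φ.reflection i • Φ.reflection i • v = v := by
  rw [smul_smul, Φ.reflection_mul_self, one_smul]

variable (Φ) in
theorem reflection_inv (i : ι) : (Φ.reflection i)⁻¹ = Φ.reflection i :=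
  inv_eq_of_mul_eq_one_left (Φ.reflection_mul_self i)

variable (Φ) in
theorem simpleRoot_reflection_smul (i : ι) (v : V) :
    Φ.simpleRoot i (Φ.reflection i • v) = -Φ.simpleRoot i v :=
  DFunLike.congr_fun (Φ.reflection_smul_simpleRoot i) v

theorem reflection_smul_mem_roots (hα : α ∈ Φ.roots) :
    DomMulAct.mk (Φ.reflection i) • α ∈ Φ.roots := by
  have of_pos {β : V →+ ℤ} (hβ : β ∈ Φ.posRoots) : DomMulAct.mk (Φ.reflection i) • β ∈ Φ.roots := by
    by_cases hβi : β = Φ.simpleRoot i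
    · rw [hβi, Φ.reflection_smul_simpleRoot, neg_mem_roots]
      exact Φ.simpleRoot_mem_roots i
    · exact posRoots_subset_roots (Φ.reflection_smul_mem i β hβ hβi)
  rcases mem_roots.1 hα with hpos | hneg
  · exact of_pos hpos
  · rw [← neg_mem_roots, ← smul_neg]
    exact of_pos hneg

theorem smul_mem_roots (g : W) (hα : α ∈ Φ.roots) : DomMulAct.mk g • α ∈ Φ.roots := by
  have hg : g ∈ Subgroup.closure (Set.range Φ.reflection) := by simp [Φ.closure_reflection]
  induction hg using Subgroup.closure_induction'' generalizing α with
  | mem _ hx => obtain ⟨i, rfl⟩ := hx; exact reflection_smul_mem_roots hα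
  | inv_mem _ hx =>
    obtain ⟨i, rfl⟩ := hx
    rw [reflection_inv]
    exact reflection_smul_mem_roots hα
  | one => simpa using hα
  | mul g h _ _ ihg ihh => rw [DomMulAct.mk_mul, mul_smul]; exact ihh (ihg hα)

theorem smul_mem_roots_iff (g : W) : DomMulAct.mk g • α ∈ Φ.roots ↔ α ∈ Φ.roots := by
  refine ⟨fun h => ?_, smul_mem_roots g⟩
  simpa [smul_smul, ← DomMulAct.mk_mul] using smul_mem_roots g⁻¹ h

theorem smul_faceMul (g : W) (v u : V) : g • Φ.faceMul v u = Φ.faceMul (g • v) (g • u) := by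
  have hsum : ∑ α ∈ Φ.roots, |α (g • u)| = ∑ α ∈ Φ.roots, |α u| :=
    Finset.sum_equiv (MulAction.toPerm (DomMulAct.mk g)) (fun _ => (smul_mem_roots_iff g).symm)
      fun _ _ => rfl
  rw [faceMul, faceMul, hsum, smul_add, smul_comm]

theorem SameFace.smul (g : W) (h : Φ.SameFace v u) : Φ.SameFace (g • v) (g • u) :=
  fun _ hα => h _ (smul_mem_roots g hα)

theorem mem_zeroSet_smul {g : W} : α ∈ Φ.zeroSet (g • v) ↔ DomMulAct.mk g • α ∈ Φ.zeroSet v := by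
  rw [mem_zeroSet, mem_zeroSet, smul_mem_roots_iff, DomMulAct.mk_smul_addMonoidHom_apply]

theorem zeroSet_smul_subset_smul_iff (g : W) :
    Φ.zeroSet (g • v) ⊆ Φ.zeroSet (g • u) ↔ Φ.zeroSet v ⊆ Φ.zeroSet u := by
  refine ⟨fun h α hα => ?_, fun h α hα => mem_zeroSet_smul.2 (h (mem_zeroSet_smul.1 hα))⟩
  have := h (mem_zeroSet_smul.2 (by simpa using hα) : (DomMulAct.mk g)⁻¹ • α ∈ _)
  simpa using mem_zeroSet_smul.1 this

theorem zeroSet_smul_congr (g : W) (h : Φ.zeroSet v = Φ.zeroSet u) :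
    Φ.zeroSet (g • v) = Φ.zeroSet (g • u) :=
  subset_antisymm ((zeroSet_smul_subset_smul_iff g).2 h.subset)
    ((zeroSet_smul_subset_smul_iff g).2 h.superset)

theorem card_zeroSet_smul (g : W) (v : V) : (Φ.zeroSet (g • v)).card = (Φ.zeroSet v).card :=
  Finset.card_equiv (MulAction.toPerm (DomMulAct.mk g)) fun _ => mem_zeroSet_smul

theorem eq_one_of_isStrictDominant_smul {g : W} (hv : Φ.IsDominant v)
    (hg : Φ.IsStrictDominant (g • v)) : g = 1 :=
  Φ.eq_one_of_smul_mem g fun α hα =>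
    mem_posRoots_of_pos (smul_mem_roots g (posRoots_subset_roots hα)) hv (hg α hα)

variable (Φ) in
/-- Two vectors are related if the flats spanned by their faces are conjugate. -/
def flatSetoid : Setoid V where
  r v u := ∃ g : W, Φ.zeroSet v = Φ.zeroSet (g • u)
  iseqv.refl v := ⟨1, by rw [one_smul]⟩
  iseqv.symm := fun {v u} ⟨g, hg⟩ => ⟨g⁻¹, by simpa using (zeroSet_smul_congr g⁻¹ hg).symm⟩
  iseqv.trans := fun {v u w} ⟨g, hg⟩ ⟨h, hh⟩ =>
    ⟨g * h, by rw [hg, mul_smul, zeroSet_smul_congr g hh]⟩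

variable (Φ) in
/-- The number of group elements that send `u` into the flat spanned by the face of `v`. -/
noncomputable def flatCount (u v : V) : ℕ := Nat.card {g : W // Φ.zeroSet v ⊆ Φ.zeroSet (g • u)}

theorem flatCount_congr {u' : V} (h : Φ.flatSetoid u u') (v : V) :
    Φ.flatCount u v = Φ.flatCount u' v := by
  obtain ⟨g, hg⟩ := h
  refine Nat.card_congr ((Equiv.mulRight g).subtypeEquiv fun x => ?_)
  rw [zeroSet_smul_congr x hg, smul_smul, Equiv.coe_mulRight]

theorem flatCount_self_ne_zero [Finite W] (v : V) : Φ.flatCount v v ≠ 0 :=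
  Nat.card_ne_zero.2 ⟨⟨⟨1, by rw [one_smul]⟩⟩, inferInstance⟩

theorem flatSetoid_of_flatCount_ne_zero (h : Φ.flatCount u v ≠ 0)
    (hcard : (Φ.zeroSet u).card ≤ (Φ.zeroSet v).card) : Φ.flatSetoid u v := by
  obtain ⟨g, hg⟩ := (Nat.card_ne_zero.1 h).1
  exact Φ.flatSetoid.symm
    ⟨g, Finset.eq_of_subset_of_card_le hg ((card_zeroSet_smul g u).trans_le hcard)⟩

/-! ### Inversions and length -/

variable (Φ) in
theorem isDominant_weight (i : ι) : Φ.IsDominant (Φ.weight i) := by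
  refine isDominant_iff_simpleRoot.2 fun j => ?_
  rcases eq_or_ne j i with rfl | hne
  · exact (Φ.simpleRoot_weight_self j).le
  · exact (Φ.simpleRoot_weight_of_ne j i hne).ge

open Classical in
theorem reflection_smul_mem_erase (hα : α ∈ Φ.posRoots.erase (Φ.simpleRoot i)) :
    DomMulAct.mk (Φ.reflection i) • α ∈ Φ.posRoots.erase (Φ.simpleRoot i) := by
  obtain ⟨hne, hpos⟩ := Finset.mem_erase.1 hα
  refine Finset.mem_erase.2 ⟨fun h => ?_, Φ.reflection_smul_mem i α hpos hne⟩
  have hneg : α = -Φ.simpleRoot i := by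
    rw [← Φ.reflection_smul_simpleRoot, ← h, smul_smul, ← DomMulAct.mk_mul, Φ.reflection_mul_self,
      DomMulAct.mk_one, one_smul]
  have hweight := Φ.isDominant_weight i α hpos
  rw [hneg, AddMonoidHom.neg_apply, neg_nonneg] at hweight
  exact hweight.not_gt (Φ.simpleRoot_weight_self i)

open Classical in
theorem card_inversions_reflection_smul_erase (i : ι) (v : V) :
    ((Φ.inversions (Φ.reflection i • v)).erase (Φ.simpleRoot i)).card =
      ((Φ.inversions v).erase (Φ.simpleRoot i)).card := by
  have card_le (v : V) : ((Φ.inversions (Φ.reflection i • v)).erase (Φ.simpleRoot i)).card ≤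
      ((Φ.inversions v).erase (Φ.simpleRoot i)).card := by
    refine Finset.card_le_card_of_injOn (DomMulAct.mk (Φ.reflection i) • ·) (fun α hα => ?_)
      (MulAction.injective _).injOn
    obtain ⟨hne, hinv⟩ := Finset.mem_erase.1 hα
    obtain ⟨hpos, hneg⟩ := mem_inversions.1 hinv
    obtain ⟨hne', hpos'⟩ :=
      Finset.mem_erase.1 (reflection_smul_mem_erase (Finset.mem_erase.2 ⟨hne, hpos⟩))
    exact Finset.mem_erase.2 ⟨hne', mem_inversions.2 ⟨hpos', hneg⟩⟩
  refine le_antisymm (card_le v) ?_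
  simpa only [reflection_smul_reflection_smul] using card_le (Φ.reflection i • v)

theorem card_inversions_reflection_smul_le (i : ι) (v : V) :
    (Φ.inversions (Φ.reflection i • v)).card ≤ (Φ.inversions v).card + 1 := by
  classical
  calc (Φ.inversions (Φ.reflection i • v)).card
      ≤ ((Φ.inversions (Φ.reflection i • v)).erase (Φ.simpleRoot i)).card + 1 :=
        Nat.le_add_of_sub_le Finset.pred_card_le_card_erase
    _ = ((Φ.inversions v).erase (Φ.simpleRoot i)).card + 1 := by
        rw [card_inversions_reflection_smul_erase]
    _ ≤ (Φ.inversions v).card + 1 := Nat.add_le_add_right Finset.card_erase_le 1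

theorem card_inversions_reflection_smul_add_one (h : Φ.simpleRoot i v < 0) :
    (Φ.inversions (Φ.reflection i • v)).card + 1 = (Φ.inversions v).card := by
  classical
  have hmem : Φ.simpleRoot i ∈ Φ.inversions v := mem_inversions.2 ⟨Φ.simpleRoot_mem i, h⟩
  have hnotMem : Φ.simpleRoot i ∉ Φ.inversions (Φ.reflection i • v) := fun hmem' => by
    have := (mem_inversions.1 hmem').2
    rw [simpleRoot_reflection_smul] at this
    omega
  rw [← Finset.card_erase_add_one hmem, ← card_inversions_reflection_smul_erase,
    Finset.erase_eq_of_notMem hnotMem]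

variable (Φ) in
theorem exists_isDominant_smul (v : V) : ∃ g : W, Φ.IsDominant (g • v) := by
  induction hN : (Φ.inversions v).card using Nat.strong_induction_on generalizing v with
  | _ N ih =>
    by_cases hd : Φ.IsDominant v
    · exact ⟨1, by rwa [one_smul]⟩
    · obtain ⟨i, hi⟩ := exists_simpleRoot_neg hd
      have hcard := card_inversions_reflection_smul_add_one hi
      obtain ⟨g, hg⟩ := ih _ (by omega) (Φ.reflection i • v) rfl
      exact ⟨g * Φ.reflection i, by rwa [mul_smul]⟩

theorem exists_isStrictDominant_smul (hv : ∀ α ∈ Φ.roots, α v ≠ 0) :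
    ∃ g : W, Φ.IsStrictDominant (g • v) := by
  obtain ⟨g, hg⟩ := Φ.exists_isDominant_smul v
  exact ⟨g, fun α hα => (hg α hα).lt_of_ne' (hv _ (smul_mem_roots g (posRoots_subset_roots hα)))⟩

theorem reflection_closure_le_stabilizer {J : Set ι} (hJ : J ⊆ Φ.simpleZeros v) :
    Subgroup.closure (Φ.reflection '' J) ≤ MulAction.stabilizer W v := by
  rw [Subgroup.closure_le]
  rintro _ ⟨i, hi, rfl⟩
  exact Φ.reflection_smul_eq_self i v (hJ hi)

theorem card_inversions_le_of_smul_eq_self (hv : Φ.IsDominant v)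
    (h : Φ.IsStrictDominant (Φ.faceMul v w)) {g : W} (hg : g • v = v) :
    (Φ.inversions w).card ≤ (Φ.inversions (g⁻¹ • w)).card := by
  refine Finset.card_le_card_of_injOn (DomMulAct.mk g • ·) (fun α hα => ?_)
    (MulAction.injective _).injOn
  obtain ⟨hpos, hneg⟩ := mem_inversions.1 hα
  have hαv : 0 < α v := ((faceMul_pos_iff (posRoots_subset_roots hpos)).1 (h α hpos)).resolve_right
    fun hw => hneg.not_gt hw.2
  refine mem_inversions.2 ⟨?_, by simpa using hneg⟩
  exact mem_posRoots_of_pos (smul_mem_roots g (posRoots_subset_roots hpos)) hv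
    (by simpa [hg] using hαv)

/-! ### Sums of minimal coset representatives -/

section ParabolicSum

variable (Φ) (k : Type*) [Field k] [Finite W]

/-- The sum of the minimal representatives of the left cosets of the parabolic subgroup of `J`,
where `J` is a set of indices of simple reflections. -/
noncomputable def parabolicSum (J : Set ι) : MonoidAlgebra k W :=
  cosetSum k (Set.range Φ.reflection) (Φ.reflection '' J)

open Classical in
theorem coeff_parabolicSum (J : Set ι) (g : W) : (Φ.parabolicSum k J).coeff g =
    if g ∈ minCosetReps (Set.range Φ.reflection) (Φ.reflection '' J) then 1 else 0 := by
  simp [parabolicSum, cosetSum, MonoidAlgebra.coeff_sum, Finsupp.single_apply]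

/-- `parabolicSum` as an element of the descent algebra. -/
noncomputable def parabolicElt (J : Set ι) : descentAlgebra k (Set.range Φ.reflection) :=
  descentElt k (Set.range Φ.reflection) (Φ.reflection '' J) (Set.image_subset_range _ _)

theorem mem_span_parabolicElt {s : Set (Set ι)} {x : descentAlgebra k (Set.range Φ.reflection)}
    (h : (x : MonoidAlgebra k W) ∈ Submodule.span k (Φ.parabolicSum k '' s)) :
    x ∈ Submodule.span k (Φ.parabolicElt k '' s) := by
  have himage : Φ.parabolicSum k '' s = (descentAlgebra k (Set.range Φ.reflection)).val.toLinearMap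
    '' (Φ.parabolicElt k '' s) := by
    rw [Set.image_image]
    rfl
  rw [himage, ← Submodule.map_span] at h
  obtain ⟨y, hy, hyx⟩ := h
  rwa [← Subtype.ext hyx]

end ParabolicSum

variable [Finite ι]

variable (Φ) in
/-- A dominant vector whose vanishing simple roots are those with index in `J`, so that its
stabilizer is the parabolic subgroup of `J`. -/
noncomputable def faceVec (J : Set ι) : V := ∑ᶠ i ∈ Jᶜ, Φ.weight i

variable (Φ) in
/-- A vector in the open fundamental chamber. -/
noncomputable def rho : V := Φ.faceVec ∅

theorem simpleRoot_faceVec_of_mem {J : Set ι} (hi : i ∈ J) :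
    Φ.simpleRoot i (Φ.faceVec J) = 0 := by
  rw [faceVec, AddMonoidHom.map_finsum_mem _ _ (Set.toFinite _)]
  exact finsum_mem_eq_zero_of_forall_eq_zero fun j hj =>
    Φ.simpleRoot_weight_of_ne i j fun hij => hj (hij ▸ hi)

theorem simpleRoot_faceVec_of_notMem {J : Set ι} (hi : i ∉ J) :
    Φ.simpleRoot i (Φ.faceVec J) = Φ.simpleRoot i (Φ.weight i) := by
  rw [faceVec, AddMonoidHom.map_finsum_mem _ _ (Set.toFinite _), finsum_mem_def,
    finsum_eq_single _ i fun j hji => ?_, Set.indicator_of_mem (Set.mem_compl hi)]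
  rw [Set.indicator_apply_eq_zero]
  exact fun _ => Φ.simpleRoot_weight_of_ne i j hji.symm

variable (Φ) in
theorem isDominant_faceVec (J : Set ι) : Φ.IsDominant (Φ.faceVec J) :=
  isDominant_iff_simpleRoot.2 fun i => by
    by_cases hi : i ∈ J
    · exact (simpleRoot_faceVec_of_mem hi).ge
    · exact (Φ.simpleRoot_weight_self i).le.trans (simpleRoot_faceVec_of_notMem hi).ge

variable (Φ) in
theorem simpleZeros_faceVec (J : Set ι) : Φ.simpleZeros (Φ.faceVec J) = J := by
  ext i
  refine ⟨fun h => ?_, simpleRoot_faceVec_of_mem⟩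
  by_contra hi
  exact (Φ.simpleRoot_weight_self i).ne' ((simpleRoot_faceVec_of_notMem hi).symm.trans h)

variable (Φ) in
theorem isStrictDominant_rho : Φ.IsStrictDominant Φ.rho :=
  isStrictDominant_iff_simpleRoot.2 fun i => by
    rw [rho, simpleRoot_faceVec_of_notMem (Set.notMem_empty i)]
    exact Φ.simpleRoot_weight_self i

theorem smul_rho_ne_zero (g : W) (hα : α ∈ Φ.roots) : α (g • Φ.rho) ≠ 0 := by
  have hmem := smul_mem_roots g hα
  rcases mem_roots.1 hmem with hpos | hneg
  · exact (Φ.isStrictDominant_rho _ hpos).ne'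
  · exact neg_ne_zero.1 (Φ.isStrictDominant_rho _ hneg).ne'

theorem eq_one_of_isDominant_smul_rho {g : W} (h : Φ.IsDominant (g • Φ.rho)) : g = 1 :=
  eq_one_of_isStrictDominant_smul Φ.isStrictDominant_rho.isDominant fun α hα =>
    (h α hα).lt_of_ne' (smul_rho_ne_zero g (posRoots_subset_roots hα))

theorem exists_list_prod_eq (g : W) : ∃ l : List W, (∀ x ∈ l, x ∈ Set.range Φ.reflection) ∧
    l.length = (Φ.inversions (g⁻¹ • Φ.rho)).card ∧ l.prod = g := by
  induction hN : (Φ.inversions (g⁻¹ • Φ.rho)).card using Nat.strong_induction_on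
    generalizing g with
  | _ N ih =>
    by_cases hd : Φ.IsDominant (g⁻¹ • Φ.rho)
    · refine ⟨[], by simp, ?_, (inv_eq_one.1 (eq_one_of_isDominant_smul_rho hd)).symm⟩
      rw [← hN, inversions_eq_empty_iff.2 hd, List.length_nil, Finset.card_empty]
    · obtain ⟨i, hi⟩ := exists_simpleRoot_neg hd
      have hcard := card_inversions_reflection_smul_add_one hi
      have hinv : (g * Φ.reflection i)⁻¹ • Φ.rho = Φ.reflection i • g⁻¹ • Φ.rho := by
        rw [mul_inv_rev, reflection_inv, mul_smul]
      rw [← hinv, hN] at hcard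
      obtain ⟨l, hl, hlen, hprod⟩ := ih _ (by omega) (g * Φ.reflection i) rfl
      refine ⟨l ++ [Φ.reflection i], fun x hx => ?_, ?_, ?_⟩
      · rcases List.mem_append.1 hx with hx | hx
        · exact hl x hx
        · exact ⟨i, (List.mem_singleton.1 hx).symm⟩
      · rw [List.length_append, List.length_singleton, hlen, hcard]
      · rw [List.prod_append, hprod, List.prod_singleton, mul_assoc, Φ.reflection_mul_self, mul_one]

theorem card_inversions_prod_inv_le (l : List W) (hl : ∀ x ∈ l, x ∈ Set.range Φ.reflection) :
    (Φ.inversions (l.prod⁻¹ • Φ.rho)).card ≤ l.length := by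
  induction l using List.reverseRecOn with
  | nil =>
    rw [List.prod_nil, inv_one, one_smul,
      inversions_eq_empty_iff.2 Φ.isStrictDominant_rho.isDominant, Finset.card_empty]
    exact Nat.zero_le _
  | append_singleton l x ih =>
    obtain ⟨i, rfl⟩ := hl x (by simp)
    have hle := card_inversions_reflection_smul_le (Φ := Φ) i (l.prod⁻¹ • Φ.rho)
    rw [List.prod_append, List.prod_singleton, mul_inv_rev, reflection_inv, mul_smul,
      List.length_append, List.length_singleton]
    exact hle.trans (Nat.add_le_add_right (ih fun x hx => hl x (by simp [hx])) 1)

variable (Φ) in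
theorem wordLength_eq_card_inversions (g : W) :
    wordLength (Set.range Φ.reflection) g = (Φ.inversions (g⁻¹ • Φ.rho)).card := by
  obtain ⟨l, hl, hlen, hprod⟩ := exists_list_prod_eq (Φ := Φ) g
  refine le_antisymm (Nat.sInf_le ⟨l, hl, hlen, hprod⟩) (le_csInf ⟨_, l, hl, hlen, hprod⟩ ?_)
  rintro _ ⟨l', hl', rfl, rfl⟩
  exact card_inversions_prod_inv_le l' hl'

/-! ### Stabilizers and minimal coset representatives -/

/-- The closed chamber is a fundamental domain, and stabilizers of its points are generated by
simple reflections. -/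
theorem smul_eq_self_and_mem_closure_of_isDominant (hv : Φ.IsDominant v) {g : W}
    (hg : Φ.IsDominant (g⁻¹ • v)) :
    g⁻¹ • v = v ∧ g ∈ Subgroup.closure (Φ.reflection '' Φ.simpleZeros v) := by
  induction hN : (Φ.inversions (g⁻¹ • Φ.rho)).card using Nat.strong_induction_on
    generalizing g with
  | _ N ih =>
    by_cases hd : Φ.IsDominant (g⁻¹ • Φ.rho)
    · obtain rfl : g = 1 := inv_eq_one.1 (eq_one_of_isDominant_smul_rho hd)
      exact ⟨by rw [inv_one, one_smul], one_mem _⟩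
    obtain ⟨i, hi⟩ := exists_simpleRoot_neg hd
    have hcard := card_inversions_reflection_smul_add_one hi
    have hmul (x : V) : (g * Φ.reflection i)⁻¹ • x = Φ.reflection i • g⁻¹ • x := by
      rw [mul_inv_rev, reflection_inv, mul_smul]
    have hzero : Φ.simpleRoot i (g⁻¹ • v) = 0 := by
      refine le_antisymm (not_lt.1 fun hpos => ?_) (hg _ (Φ.simpleRoot_mem i))
      have hroot := mem_posRoots_of_pos (smul_mem_roots g⁻¹ (Φ.simpleRoot_mem_roots i)) hv hpos
      exact hi.not_gt (Φ.isStrictDominant_rho _ hroot)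
    have hfix : (g * Φ.reflection i)⁻¹ • v = g⁻¹ • v := by
      rw [hmul, Φ.reflection_smul_eq_self i _ hzero]
    obtain ⟨hself, hmem⟩ := ih _ (by rw [hmul]; omega) (by rwa [hfix]) rfl
    rw [hfix] at hself
    refine ⟨hself, ?_⟩
    have hi_mem : Φ.reflection i ∈ Subgroup.closure (Φ.reflection '' Φ.simpleZeros v) :=
      Subgroup.subset_closure ⟨i, hself ▸ hzero, rfl⟩
    simpa [mul_assoc, Φ.reflection_mul_self] using mul_mem hmem hi_mem

theorem stabilizer_le_of_zeroSet_subset (hv : Φ.IsDominant v) (h : Φ.zeroSet v ⊆ Φ.zeroSet u) :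
    MulAction.stabilizer W v ≤ MulAction.stabilizer W u := by
  intro g hg
  have hfix : g⁻¹ • v = v := (MulAction.stabilizer W v).inv_mem hg
  refine reflection_closure_le_stabilizer (fun i hi => ?_)
    (smul_eq_self_and_mem_closure_of_isDominant hv (by rwa [hfix])).2
  exact (mem_zeroSet.1 (h (mem_zeroSet.2 ⟨Φ.simpleRoot_mem_roots i, hi⟩))).2

theorem card_stabilizer_le [Finite W] (hv : Φ.IsDominant v) (g : W)
    (h : Φ.zeroSet v ⊆ Φ.zeroSet (g • u)) :
    Nat.card (MulAction.stabilizer W v) ≤ Nat.card (MulAction.stabilizer W u) := by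
  rw [Nat.card_congr (MulAction.stabilizerEquivStabilizer (g := g) (a := u) rfl).toEquiv]
  exact Subgroup.card_le_of_le (stabilizer_le_of_zeroSet_subset hv h)

theorem card_stabilizer_congr [Finite W] (hv : Φ.IsDominant v) (hu : Φ.IsDominant u)
    (h : Φ.flatSetoid v u) :
    Nat.card (MulAction.stabilizer W v) = Nat.card (MulAction.stabilizer W u) := by
  obtain ⟨g, hg⟩ := h
  obtain ⟨g', hg'⟩ := Φ.flatSetoid.symm ⟨g, hg⟩
  exact le_antisymm (card_stabilizer_le hv g hg.subset) (card_stabilizer_le hu g' hg'.subset)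

theorem mem_minCosetReps_iff {J : Set ι} {g : W} :
    g ∈ minCosetReps (Set.range Φ.reflection) (Φ.reflection '' J) ↔
      ∀ i ∈ J, 0 < Φ.simpleRoot i (g⁻¹ • Φ.rho) := by
  simp only [minCosetReps, Set.mem_ofPred_eq, wordLength_eq_card_inversions, mul_inv_rev, mul_smul]
  refine ⟨fun h i hi => ?_, fun h x hx => ?_⟩
  · by_contra hle
    have hlt := (not_lt.1 hle).lt_of_ne (smul_rho_ne_zero g⁻¹ (Φ.simpleRoot_mem_roots i))
    have hcard := card_inversions_reflection_smul_add_one hlt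
    have hmin := h _ (Subgroup.subset_closure ⟨i, hi, rfl⟩)
    rw [reflection_inv] at hmin
    omega
  · have hfix := reflection_closure_le_stabilizer (Φ.simpleZeros_faceVec J).superset hx
    refine card_inversions_le_of_smul_eq_self (Φ.isDominant_faceVec J)
      (isStrictDominant_faceMul (Φ.isDominant_faceVec J) fun i hi => h i ?_) hfix
    rwa [simpleZeros_faceVec] at hi

theorem exists_ascents_eq (K : Set ι) :
    ∃ g : W, ∀ i, 0 < Φ.simpleRoot i (g⁻¹ • Φ.rho) ↔ i ∈ K := by
  obtain ⟨g, hg⟩ := exists_isStrictDominant_smul (Φ := Φ)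
    (v := Φ.faceMul (Φ.faceVec Kᶜ) (-Φ.rho)) fun α hα h0 => by
      have := ((faceMul_eq_zero_iff hα).1 h0).2
      rw [map_neg, neg_eq_zero, ← one_smul W Φ.rho] at this
      exact smul_rho_ne_zero 1 hα this
  have hface := (Φ.isStrictDominant_rho.sameFace hg).smul g⁻¹
  rw [inv_smul_smul] at hface
  refine ⟨g, fun i => ?_⟩
  have hrho := Φ.isStrictDominant_rho _ (Φ.simpleRoot_mem i)
  have hmem := Φ.simpleRoot_mem_roots i
  rw [hface _ hmem, faceMul_pos_iff hmem, map_neg]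
  by_cases hi : i ∈ K
  · simp [simpleRoot_faceVec_of_notMem (Set.notMem_compl_iff.2 hi), Φ.simpleRoot_weight_self i, hi]
  · simp [simpleRoot_faceVec_of_mem (Set.mem_compl hi), hi, hrho.le]

/-! ### Chambers and orbit sums -/

variable (Φ) in
theorem existsUnique_chamber (v : V) :
    ∃! w : W, Φ.IsStrictDominant (w⁻¹ • Φ.faceMul v Φ.rho) := by
  obtain ⟨g, hg⟩ := exists_isStrictDominant_smul (Φ := Φ) (v := Φ.faceMul v Φ.rho)
    fun α hα h0 => by
      rw [faceMul_eq_zero_iff hα, ← one_smul W Φ.rho] at h0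
      exact smul_rho_ne_zero 1 hα h0.2
  refine ⟨g⁻¹, by simpa only [inv_inv] using hg, fun w hw => eq_inv_of_mul_eq_one_right ?_⟩
  exact eq_one_of_isStrictDominant_smul hw.isDominant (by rwa [mul_smul, smul_inv_smul])

variable (Φ) in
/-- The group element `w` for which `w C` is the product of the face of `v` and of the fundamental
chamber `C`. -/
noncomputable def chamber (v : V) : W := (Φ.existsUnique_chamber v).choose

theorem chamber_eq_iff {w : W} :
    Φ.chamber v = w ↔ Φ.IsStrictDominant (w⁻¹ • Φ.faceMul v Φ.rho) := by
  have h := (Φ.existsUnique_chamber v).choose_spec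
  exact ⟨fun hw => hw ▸ h.1, fun hw => (h.2 w hw).symm⟩

theorem isStrictDominant_inv_chamber_smul (v : V) :
    Φ.IsStrictDominant ((Φ.chamber v)⁻¹ • Φ.faceMul v Φ.rho) :=
  chamber_eq_iff.1 rfl

theorem chamber_congr (h : Φ.SameFace v u) : Φ.chamber v = Φ.chamber u :=
  chamber_eq_iff.2 ((isStrictDominant_inv_chamber_smul u).of_sameFace
    ((h.symm.faceMul (SameFace.refl _)).smul _))

theorem chamber_mul_chamber (u v : V) :
    Φ.chamber u * Φ.chamber v = Φ.chamber (Φ.faceMul (Φ.chamber u • v) u) := by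
  refine (chamber_eq_iff.2 ?_).symm
  have hface : Φ.SameFace
      ((Φ.chamber u)⁻¹ • Φ.faceMul (Φ.faceMul (Φ.chamber u • v) u) Φ.rho)
      (Φ.faceMul v Φ.rho) := by
    refine ((sameFace_faceMul_assoc _ _ _).smul _).trans ?_
    rw [smul_faceMul, inv_smul_smul]
    exact (SameFace.refl v).faceMul
      ((isStrictDominant_inv_chamber_smul u).sameFace Φ.isStrictDominant_rho)
  rw [mul_inv_rev, mul_smul]
  exact (isStrictDominant_inv_chamber_smul v).of_sameFace (hface.symm.smul _)

theorem chamber_smul_eq_iff (hv : Φ.IsDominant v) {g w : W} :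
    Φ.chamber (g • v) = w ↔
      w ∈ minCosetReps (Set.range Φ.reflection) (Φ.reflection '' Φ.simpleZeros v) ∧
        g⁻¹ * w ∈ MulAction.stabilizer W v := by
  rw [chamber_eq_iff, smul_faceMul, mem_minCosetReps_iff]
  have hmul : w⁻¹ • g • v = (g⁻¹ * w)⁻¹ • v := by rw [mul_inv_rev, inv_inv, mul_smul]
  constructor
  · intro h
    have hdom := IsDominant.of_faceMul h
    rw [hmul] at hdom
    have hfix := (smul_eq_self_and_mem_closure_of_isDominant hv hdom).1
    rw [hmul, hfix] at h
    refine ⟨fun i hi => ?_, inv_mem_iff.1 hfix⟩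
    have hpos := (faceMul_pos_iff (Φ.simpleRoot_mem_roots i)).1 (h _ (Φ.simpleRoot_mem i))
    exact (hpos.resolve_left fun hlt => hlt.ne' hi).2
  · rintro ⟨hmin, hstab⟩
    have hfix : (g⁻¹ * w)⁻¹ • v = v := inv_mem hstab
    rw [hmul, hfix]
    exact isStrictDominant_faceMul hv hmin

section OrbitSum

variable [Fintype W]

open Classical in
theorem card_filter_chamber_smul_eq (hv : Φ.IsDominant v) {w : W}
    (hw : w ∈ minCosetReps (Set.range Φ.reflection) (Φ.reflection '' Φ.simpleZeros v)) :
    (Finset.univ.filter fun g : W => Φ.chamber (g • v) = w).card =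
      Nat.card (MulAction.stabilizer W v) := by
  rw [Nat.subtype_card (Finset.univ.filter fun g => g ∈ MulAction.stabilizer W v) (by simp)]
  refine Finset.card_equiv ((Equiv.inv W).trans (Equiv.mulRight w)) fun g => ?_
  simp [chamber_smul_eq_iff hv, hw]

variable (k : Type*) [Field k]

variable (Φ) in
/-- The sum over the orbit of the face of a vector, each face being represented by its product
with the fundamental chamber. -/
noncomputable def orbitSum (v : V) : MonoidAlgebra k W :=
  ∑ h : W, MonoidAlgebra.of k W (Φ.chamber (h • v))

theorem orbitSum_smul (g : W) (v : V) : Φ.orbitSum k (g • v) = Φ.orbitSum k v := by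
  simp only [orbitSum, smul_smul]
  exact Equiv.sum_comp (Equiv.mulRight g) fun h => MonoidAlgebra.of k W (Φ.chamber (h • v))

theorem orbitSum_congr (h : Φ.SameFace v u) : Φ.orbitSum k v = Φ.orbitSum k u :=
  Finset.sum_congr rfl fun g _ => by rw [chamber_congr (h.smul g)]

theorem of_chamber_mul_orbitSum (u v : V) :
    MonoidAlgebra.of k W (Φ.chamber u) * Φ.orbitSum k v =
      ∑ h : W, MonoidAlgebra.of k W (Φ.chamber (Φ.faceMul (h • v) u)) := by
  simp only [orbitSum, Finset.mul_sum, ← map_mul, chamber_mul_chamber, smul_smul]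
  exact Equiv.sum_comp (Equiv.mulLeft (Φ.chamber u)) fun h =>
    MonoidAlgebra.of k W (Φ.chamber (Φ.faceMul (h • v) u))

theorem orbitSum_mul_orbitSum (u v : V) :
    Φ.orbitSum k u * Φ.orbitSum k v = ∑ g : W, Φ.orbitSum k (Φ.faceMul v (g • u)) :=
  calc Φ.orbitSum k u * Φ.orbitSum k v
      = ∑ g : W, ∑ h : W, MonoidAlgebra.of k W (Φ.chamber (Φ.faceMul (h • v) (g • u))) := by
        rw [orbitSum, Finset.sum_mul]
        exact Finset.sum_congr rfl fun g _ => of_chamber_mul_orbitSum k _ v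
    _ = ∑ h : W, ∑ g : W, MonoidAlgebra.of k W (Φ.chamber (Φ.faceMul (h • v) ((h * g) • u))) := by
        rw [Finset.sum_comm]
        exact Finset.sum_congr rfl fun h _ => (Equiv.sum_comp (Equiv.mulLeft h) _).symm
    _ = ∑ g : W, Φ.orbitSum k (Φ.faceMul v (g • u)) := by
        rw [Finset.sum_comm]
        simp only [orbitSum, smul_faceMul, mul_smul]

theorem orbitSum_of_isDominant (hv : Φ.IsDominant v) :
    Φ.orbitSum k v = (Nat.card (MulAction.stabilizer W v) : k) •
      cosetSum k (Set.range Φ.reflection) (Φ.reflection '' Φ.simpleZeros v) := by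
  classical
  rw [orbitSum, cosetSum, Finset.smul_sum, ← Finset.sum_fiberwise_of_maps_to
    (t := (Set.toFinite (minCosetReps _ (Φ.reflection '' Φ.simpleZeros v))).toFinset)
    (g := fun g : W => Φ.chamber (g • v))
    fun g _ => (Set.Finite.mem_toFinset _).2 ((chamber_smul_eq_iff hv).1 rfl).1]
  refine Finset.sum_congr rfl fun w hw => ?_
  rw [← card_filter_chamber_smul_eq hv ((Set.Finite.mem_toFinset _).1 hw),
    Nat.cast_smul_eq_nsmul, ← Finset.sum_const]
  exact Finset.sum_congr rfl fun g hg => by rw [(Finset.mem_filter.1 hg).2]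

end OrbitSum

/-! ### The basis of the descent algebra -/

section ParabolicCoeff

variable (Φ) (k : Type*) [Field k]

/-- The number of roots that vanish on the faces of type `J`. -/
noncomputable def parabolicRank (J : Set ι) : ℕ := (Φ.zeroSet (Φ.faceVec J)).card

/-- The coefficient of the sum for `J` in the product of the sums for `K` and for `J`. -/
noncomputable def parabolicCoeff (K J : Set ι) : k :=
  (Nat.card (MulAction.stabilizer W (Φ.faceVec K)) : k)⁻¹ *
    Φ.flatCount (Φ.faceVec K) (Φ.faceVec J)

omit [Finite ι] in
theorem flatSetoid_of_parabolicCoeff_ne_zero {K J : Set ι} (h : Φ.parabolicCoeff k K J ≠ 0)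
    (hrank : Φ.parabolicRank K ≤ Φ.parabolicRank J) :
    Φ.flatSetoid (Φ.faceVec K) (Φ.faceVec J) :=
  flatSetoid_of_flatCount_ne_zero
    (fun hcount => h (by rw [parabolicCoeff, hcount, Nat.cast_zero, mul_zero])) hrank

variable [Finite W]

theorem parabolicSum_univ : Φ.parabolicSum k Set.univ = 1 := by
  classical
  ext g
  rw [coeff_parabolicSum, MonoidAlgebra.one_def, MonoidAlgebra.coeff_single, Finsupp.single_apply]
  refine if_congr (mem_minCosetReps_iff.trans ⟨fun h => ?_, ?_⟩) rfl rfl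
  · have hg := isStrictDominant_iff_simpleRoot.2 fun i => h i trivial
    exact (inv_eq_one.1 (eq_one_of_isDominant_smul_rho hg.isDominant)).symm
  · rintro rfl i -
    rw [inv_one, one_smul]
    exact Φ.isStrictDominant_rho _ (Φ.simpleRoot_mem i)

theorem linearIndependent_parabolicSum : LinearIndependent k (Φ.parabolicSum k) := by
  classical
  cases nonempty_fintype ι
  rw [Fintype.linearIndependent_iff]
  intro a ha
  have sum_subsets (K : Set ι) : ∑ J with J ⊆ K, a J = 0 := by
    obtain ⟨g, hg⟩ := Φ.exists_ascents_eq K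
    have hcoeff : ∑ J, a J * (Φ.parabolicSum k J).coeff g = 0 := by
      simpa [MonoidAlgebra.coeff_sum] using congrArg (fun x => x.coeff g) ha
    rw [← hcoeff, Finset.sum_filter]
    refine Finset.sum_congr rfl fun J _ => ?_
    rw [coeff_parabolicSum, mul_ite, mul_one, mul_zero]
    exact if_congr (by simp [mem_minCosetReps_iff, hg, Set.subset_def]) rfl rfl
  intro K
  induction K using WellFoundedLT.induction with
  | _ K ih =>
    rw [← sum_subsets K, eq_comm]
    refine Finset.sum_eq_single_of_mem K (by simp) fun J hJ hne => ?_
    exact ih J (lt_of_le_of_ne (Finset.mem_filter.1 hJ).2 hne)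

theorem parabolicCoeff_congr {K K' : Set ι} (h : Φ.flatSetoid (Φ.faceVec K) (Φ.faceVec K'))
    (J : Set ι) : Φ.parabolicCoeff k K J = Φ.parabolicCoeff k K' J := by
  rw [parabolicCoeff, parabolicCoeff, flatCount_congr h,
    card_stabilizer_congr (Φ.isDominant_faceVec K) (Φ.isDominant_faceVec K') h]

end ParabolicCoeff

section Triangular

variable [Fintype W] (k : Type*) [Field k]

variable (Φ) in
theorem orbitSum_faceVec (J : Set ι) : Φ.orbitSum k (Φ.faceVec J) =
    (Nat.card (MulAction.stabilizer W (Φ.faceVec J)) : k) • Φ.parabolicSum k J := by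
  rw [orbitSum_of_isDominant k (Φ.isDominant_faceVec J), simpleZeros_faceVec, parabolicSum]

theorem orbitSum_mem_rankSpan {m : ℕ} (h : (Φ.zeroSet v).card < m) :
    Φ.orbitSum k v ∈ rankSpan k (Φ.parabolicSum k) Φ.parabolicRank m := by
  obtain ⟨g, hg⟩ := Φ.exists_isDominant_smul v
  rw [← orbitSum_smul k g, orbitSum_of_isDominant k hg]
  refine Submodule.smul_mem _ _ (Submodule.subset_span ⟨Φ.simpleZeros (g • v), ?_, rfl⟩)
  rwa [Set.mem_ofPred_eq, parabolicRank, zeroSet_eq_of_simpleZeros_eq (Φ.isDominant_faceVec _) hg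
    (Φ.simpleZeros_faceVec _), card_zeroSet_smul]

theorem orbitSum_mul_orbitSum_sub_mem (u v : V) :
    Φ.orbitSum k u * Φ.orbitSum k v - (Φ.flatCount u v : k) • Φ.orbitSum k v ∈
      rankSpan k (Φ.parabolicSum k) Φ.parabolicRank (Φ.zeroSet v).card := by
  classical
  have sum_flat : ∑ g : W with Φ.zeroSet v ⊆ Φ.zeroSet (g • u),
      Φ.orbitSum k (Φ.faceMul v (g • u)) = (Φ.flatCount u v : k) • Φ.orbitSum k v := by
    rw [flatCount, Nat.subtype_card _ fun g => Finset.mem_filter_univ g, Nat.cast_smul_eq_nsmul,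
      ← Finset.sum_const]
    exact Finset.sum_congr rfl fun g hg =>
      orbitSum_congr k (sameFace_faceMul_of_zeroSet_subset (Finset.mem_filter.1 hg).2)
  rw [orbitSum_mul_orbitSum, ← sum_flat, ← Finset.sum_filter_add_sum_filter_not Finset.univ
    fun g : W => Φ.zeroSet v ⊆ Φ.zeroSet (g • u), add_sub_cancel_left]
  exact Submodule.sum_mem _ fun g hg =>
    orbitSum_mem_rankSpan k (card_zeroSet_faceMul_lt (Finset.mem_filter.1 hg).2)

end Triangular

section Radical

variable (Φ) (k : Type*) [Field k] [CharZero k] [Finite W]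

theorem card_stabilizer_ne_zero (v : V) : (Nat.card (MulAction.stabilizer W v) : k) ≠ 0 :=
  Nat.cast_ne_zero.2 Nat.card_pos.ne'

omit [Finite ι] in
theorem parabolicCoeff_self_ne_zero (J : Set ι) : Φ.parabolicCoeff k J J ≠ 0 :=
  mul_ne_zero (inv_ne_zero (card_stabilizer_ne_zero k _))
    (Nat.cast_ne_zero.2 (flatCount_self_ne_zero _))

theorem isTriangularMul_parabolicSum :
    IsTriangularMul (Φ.parabolicSum k) Φ.parabolicRank (Φ.parabolicCoeff k) := by
  cases nonempty_fintype W
  intro K J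
  have parabolicSum_eq (J : Set ι) : Φ.parabolicSum k J =
      (Nat.card (MulAction.stabilizer W (Φ.faceVec J)) : k)⁻¹ • Φ.orbitSum k (Φ.faceVec J) := by
    rw [orbitSum_faceVec, inv_smul_smul₀ (card_stabilizer_ne_zero k _)]
  have hmem := Submodule.smul_mem _ ((Nat.card (MulAction.stabilizer W (Φ.faceVec K)) : k)⁻¹ *
    (Nat.card (MulAction.stabilizer W (Φ.faceVec J)) : k)⁻¹)
      (orbitSum_mul_orbitSum_sub_mem (Φ := Φ) k (Φ.faceVec K) (Φ.faceVec J))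
  change _ ∈ rankSpan k _ _ (Φ.zeroSet (Φ.faceVec J)).card
  convert hmem using 1
  rw [parabolicSum_eq, parabolicSum_eq, smul_mul_smul_comm, smul_sub, smul_smul, smul_smul,
    parabolicCoeff, mul_right_comm]

theorem mul_mem_span_range_parabolicSum {x y : MonoidAlgebra k W}
    (hx : x ∈ Submodule.span k (Set.range (Φ.parabolicSum k)))
    (hy : y ∈ Submodule.span k (Set.range (Φ.parabolicSum k))) :
    x * y ∈ Submodule.span k (Set.range (Φ.parabolicSum k)) := by
  have hxy := Submodule.mul_mem_mul hx hy
  rw [Submodule.span_mul_span] at hxy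
  refine Submodule.span_le.2 ?_ hxy
  rintro _ ⟨_, ⟨K, rfl⟩, _, ⟨J, rfl⟩, rfl⟩
  have hlower := Submodule.span_mono (Set.image_subset_range _ _)
    (Φ.isTriangularMul_parabolicSum k K J)
  have hdiag := Submodule.smul_mem _ (Φ.parabolicCoeff k K J)
    (Submodule.subset_span (R := k) (Set.mem_range_self (f := Φ.parabolicSum k) J))
  simpa using add_mem hlower hdiag

/-- Solomon's theorem. -/
theorem toSubmodule_descentAlgebra :
    Subalgebra.toSubmodule (descentAlgebra k (Set.range Φ.reflection)) =
      Submodule.span k (Set.range (Φ.parabolicSum k)) := by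
  refine le_antisymm ?_ (Submodule.span_le.2 ?_)
  · have hone : (1 : MonoidAlgebra k W) ∈ Submodule.span k (Set.range (Φ.parabolicSum k)) :=
      Submodule.subset_span ⟨_, Φ.parabolicSum_univ k⟩
    suffices h : descentAlgebra k (Set.range Φ.reflection) ≤ Submodule.toSubalgebra _ hone
      fun _ _ => Φ.mul_mem_span_range_parabolicSum k from h
    refine Algebra.adjoin_le ?_
    rintro _ ⟨J, hJ, rfl⟩
    refine Submodule.subset_span ⟨Φ.reflection ⁻¹' J, ?_⟩
    rw [parabolicSum, Set.image_preimage_eq_of_subset hJ]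
  · rintro _ ⟨J, rfl⟩
    exact Algebra.subset_adjoin ⟨_, Set.image_subset_range _ _, rfl⟩

/-- The basis of the descent algebra given by `parabolicElt`. -/
noncomputable def parabolicBasis :
    Module.Basis (Set ι) k (descentAlgebra k (Set.range Φ.reflection)) :=
  Module.Basis.mk (v := Φ.parabolicElt k)
    (LinearIndependent.of_comp (descentAlgebra k (Set.range Φ.reflection)).val.toLinearMap
      (Φ.linearIndependent_parabolicSum k))
    fun x _ => by
      have hx := x.2
      rw [← Subalgebra.mem_toSubmodule, toSubmodule_descentAlgebra, ← Set.image_univ] at hx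
      simpa only [Set.image_univ] using Φ.mem_span_parabolicElt k hx

theorem coe_parabolicBasis : ⇑(Φ.parabolicBasis k) = Φ.parabolicElt k := Module.Basis.coe_mk _ _

theorem isTriangularMul_parabolicBasis :
    IsTriangularMul (Φ.parabolicBasis k) Φ.parabolicRank (Φ.parabolicCoeff k) := fun K J => by
  rw [coe_parabolicBasis]
  exact Φ.mem_span_parabolicElt k (Φ.isTriangularMul_parabolicSum k K J)

theorem jacobson_descentAlgebra :
    (Ring.jacobson (descentAlgebra k (Set.range Φ.reflection))).restrictScalars k =
      Submodule.span k {x | ∃ K J, Φ.flatSetoid (Φ.faceVec K) (Φ.faceVec J) ∧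
        x = Φ.parabolicElt k K - Φ.parabolicElt k J} := by
  rw [← coe_parabolicBasis]
  exact (Φ.isTriangularMul_parabolicBasis k).jacobson_eq_span_sub (Φ.flatSetoid.comap Φ.faceVec)
    (fun _ _ J h => Φ.parabolicCoeff_congr k h J) (Φ.parabolicCoeff_self_ne_zero k)
    fun _ _ => Φ.flatSetoid_of_parabolicCoeff_ne_zero k

end Radical

end SimpleSystem

end SimpleSystem

/-! ### Signed points and odd vectors -/

namespace SignedPoint

variable {n : ℕ}

instance instNeg : Neg (SignedPoint n) := ⟨fun p => ⟨-p.1, by have := p.2; omega⟩⟩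

@[simp] theorem val_neg (p : SignedPoint n) : (-p).1 = -p.1 := rfl

instance instInvolutiveNeg : InvolutiveNeg (SignedPoint n) where
  neg_neg p := Subtype.ext (by simp)

theorem ne_neg_self (p : SignedPoint n) : p ≠ -p := fun h => by
  have := congrArg Subtype.val h
  have := p.2
  simp only [val_neg] at *
  omega

/-- The point `i + 1`. -/
def coord (i : Fin n) : SignedPoint n := ⟨i + 1, by omega⟩

/-- The index of a point up to sign, so that `p = ± coord (index p)`. -/
def index (p : SignedPoint n) : Fin n := ⟨p.1.natAbs - 1, by have := p.2; omega⟩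

@[simp] theorem val_coord (i : Fin n) : (coord i).1 = i + 1 := rfl

theorem natAbs_coord (i : Fin n) : (coord i).1.natAbs = i + 1 := by
  rw [val_coord]; omega

@[simp] theorem index_coord (i : Fin n) : index (coord i) = i :=
  Fin.ext (by simp only [index, natAbs_coord, Nat.add_sub_cancel])

theorem coord_injective : Function.Injective (coord (n := n)) :=
  Function.LeftInverse.injective index_coord

theorem coord_ne_neg_coord (i j : Fin n) : coord i ≠ -coord j := by
  rw [Ne, Subtype.ext_iff, val_neg, val_coord, val_coord]
  omega

@[simp] theorem index_neg (p : SignedPoint n) : index (-p) = index p := by simp [index]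

theorem eq_coord_index_or (p : SignedPoint n) :
    0 < p.1 ∧ p = coord (index p) ∨ p.1 < 0 ∧ p = -coord (index p) := by
  have := p.2
  simp only [Subtype.ext_iff, val_neg, val_coord, index]
  omega

theorem index_eq_index_iff {p q : SignedPoint n} : index p = index q ↔ p = q ∨ p = -q := by
  have := p.2
  have := q.2
  simp only [Fin.ext_iff, Subtype.ext_iff, index, val_neg]
  omega

theorem index_apply_coord_injective {g : SignedPoint n → SignedPoint n} (hg : g.Odd)
    (hg' : g.Injective) : Function.Injective fun i => index (g (coord i)) := by
  intro i j h
  rcases index_eq_index_iff.1 h with h | h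
  · simpa using congrArg index (hg' h)
  · simpa using congrArg index (hg' (h.trans (hg _).symm))

end SignedPoint

open SignedPoint

/-- The lattice `ℤ ^ n`, as the group of odd functions on the signed points. -/
def OddVec (n : ℕ) : AddSubgroup (SignedPoint n → ℤ) where
  carrier := {v | v.Odd}
  zero_mem' := Function.Odd.zero
  add_mem' := Function.Odd.add
  neg_mem' h p := congrArg Neg.neg (h p)

namespace OddVec

variable {n : ℕ}

theorem apply_neg (v : OddVec n) (p : SignedPoint n) : v.1 (-p) = -v.1 p := v.2 p

/-- The vector with coordinates `f 1, …, f n`. -/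
def ofNat (f : ℕ → ℤ) : OddVec n :=
  ⟨fun p => p.1.sign * f p.1.natAbs, fun p => by
    simp only [val_neg, Int.sign_neg, Int.natAbs_neg, neg_mul]⟩

@[simp] theorem ofNat_coord (f : ℕ → ℤ) (i : Fin n) : (ofNat f).1 (coord i) = f (i + 1) := by
  have hsign : (coord i).1.sign = 1 := Int.sign_eq_one_of_pos (by rw [val_coord]; omega)
  simp only [ofNat, natAbs_coord, hsign, one_mul]

/-- The functional `v ↦ v q - v p`. -/
def coordSub (p q : SignedPoint n) : OddVec n →+ ℤ where
  toFun v := v.1 q - v.1 p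
  map_zero' := sub_self _
  map_add' v u := by
    change v.1 q + u.1 q - (v.1 p + u.1 p) = _
    ring

@[simp] theorem coordSub_apply (p q : SignedPoint n) (v : OddVec n) :
    coordSub p q v = v.1 q - v.1 p := rfl

theorem coordSub_self (p : SignedPoint n) : coordSub p p = 0 := AddMonoidHom.ext fun _ => sub_self _

theorem coordSub_add_coordSub (p q r : SignedPoint n) :
    coordSub p q + coordSub q r = coordSub p r :=
  AddMonoidHom.ext fun v => by simp

theorem neg_coordSub (p q : SignedPoint n) : -coordSub p q = coordSub q p :=
  AddMonoidHom.ext fun v => by simp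

theorem coordSub_neg_neg (p q : SignedPoint n) : coordSub (-q) (-p) = coordSub p q :=
  AddMonoidHom.ext fun v => by simp only [coordSub_apply, apply_neg]; ring

end OddVec

open OddVec

/-- The pair stands for a positive root of type `D`, namely `OddVec.coordSub p q`. -/
def PosPair {n : ℕ} (p q : SignedPoint n) : Prop := p < q ∧ q ≠ -p

section TypeD

variable {n : ℕ} [hn : n.AtLeastTwo]

/-- The smaller point of the pair of a simple root. -/
def rootLo (i : Fin n) : SignedPoint n :=
  ⟨if (i : ℕ) = 0 then -1 else i, by have := hn.prop; split_ifs <;> omega⟩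

/-- The larger point of the pair of a simple root. -/
def rootHi (i : Fin n) : SignedPoint n :=
  ⟨if (i : ℕ) = 0 then 2 else i + 1, by have := hn.prop; split_ifs <;> omega⟩

theorem posPair_rootLo_rootHi (i : Fin n) : PosPair (rootLo i) (rootHi i) := by
  simp only [PosPair, ← Subtype.coe_lt_coe, Ne, Subtype.ext_iff, rootLo, rootHi, val_neg]
  split_ifs <;> omega

theorem gen_apply (i : Fin n) (p : SignedPoint n) :
    (gen n i).1 p = if p = rootLo i then rootHi i else if p = rootHi i then rootLo i else
      if p = -rootLo i then -rootHi i else if p = -rootHi i then -rootLo i else p := by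
  have := hn.prop
  apply Subtype.ext
  by_cases h : (i : ℕ) = 0
  · simp only [gen, permGen, h, dif_pos, permOnePrime, Equiv.Perm.mul_apply, Equiv.swap_apply_def,
      Subtype.ext_iff, rootLo, rootHi, val_neg, if_true, apply_ite Subtype.val]
    split_ifs <;> first | omega | contradiction
  · simp only [gen, permGen, h, dif_neg, permS, Equiv.Perm.mul_apply, Equiv.swap_apply_def,
      Subtype.ext_iff, rootLo, rootHi, val_neg, if_false, not_false_eq_true,
      apply_ite Subtype.val]
    split_ifs <;> omega

theorem gen_odd (i : Fin n) : (gen n i).1.toFun.Odd := fun p => by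
  have := p.2
  apply Subtype.ext
  simp only [Equiv.toFun_as_coe, gen_apply, Subtype.ext_iff, rootLo, rootHi, val_neg,
    apply_ite Subtype.val]
  split_ifs <;> omega

theorem gen_apply_rootLo (i : Fin n) : (gen n i).1 (rootLo i) = rootHi i := by
  simp [gen_apply]

theorem gen_apply_rootHi (i : Fin n) : (gen n i).1 (rootHi i) = rootLo i := by
  simp [gen_apply, (posPair_rootLo_rootHi i).1.ne']

theorem gen_apply_gen_apply (i : Fin n) (p : SignedPoint n) :
    (gen n i).1 ((gen n i).1 p) = p := by
  have := p.2
  apply Subtype.ext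
  simp only [gen_apply, Subtype.ext_iff, rootLo, rootHi, val_neg, apply_ite Subtype.val]
  split_ifs <;> first | omega | contradiction

theorem gen_mul_gen (i : Fin n) : gen n i * gen n i = 1 :=
  Subtype.ext (Equiv.ext fun p => gen_apply_gen_apply i p)

theorem gen_inv (i : Fin n) : (gen n i)⁻¹ = gen n i := inv_eq_of_mul_eq_one_left (gen_mul_gen i)

theorem gen_injective : Function.Injective (gen n) := by
  intro i j h
  have hval : ((gen n i).1 (rootLo j)).1 = (rootHi j).1 := by rw [h, gen_apply_rootLo]
  simp only [gen_apply, Subtype.ext_iff, rootLo, rootHi, val_neg, apply_ite Subtype.val] at hval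
  apply Fin.ext
  split_ifs at hval <;> first | omega | contradiction

theorem PosPair.gen_apply {p q : SignedPoint n} (h : PosPair p q) (i : Fin n) :
    PosPair ((gen n i).1 p) ((gen n i).1 q) ∨ (p = rootLo i ∧ q = rootHi i) ∨
      (p = -rootHi i ∧ q = -rootLo i) := by
  obtain ⟨hlt, hne⟩ := h
  have hp := p.2
  have hq := q.2
  rw [Ne, Subtype.ext_iff] at hne
  rw [← Subtype.coe_lt_coe] at hlt
  simp only [PosPair, ← Subtype.coe_lt_coe, Ne, _root_.gen_apply, Subtype.ext_iff, rootLo, rootHi,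
    val_neg, apply_ite Subtype.val] at hlt hne ⊢
  split_ifs <;> omega

theorem odd_of_mem_DGroup {g : Equiv.Perm (SignedPoint n)} (hg : g ∈ DGroup n) :
    Function.Odd g := by
  induction hg using Subgroup.closure_induction with
  | mem x hx => obtain ⟨i, rfl⟩ := hx; exact gen_odd i
  | one => exact fun _ => rfl
  | mul x y _ _ hx hy => exact hx.comp_odd hy
  | inv x _ hx =>
    intro p
    rw [Equiv.Perm.inv_eq_iff_eq, hx, Equiv.Perm.coe_inv, Equiv.apply_symm_apply]

instance OddVec.instDistribMulAction : DistribMulAction (DGroup n) (OddVec n) where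
  smul g v := ⟨fun p => v.1 (g⁻¹.1 p), Function.Odd.comp_odd v.2 (odd_of_mem_DGroup g⁻¹.2)⟩
  one_smul _ := rfl
  mul_smul g h v := Subtype.ext <| funext fun p => by
    change v.1 ((g * h)⁻¹.1 p) = v.1 (h⁻¹.1 (g⁻¹.1 p))
    rw [mul_inv_rev]
    rfl
  smul_zero _ := rfl
  smul_add _ _ _ := rfl

theorem OddVec.smul_apply (g : DGroup n) (v : OddVec n) (p : SignedPoint n) :
    (g • v).1 p = v.1 (g⁻¹.1 p) := rfl

theorem mk_smul_coordSub (g : DGroup n) (p q : SignedPoint n) :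
    DomMulAct.mk g • coordSub p q = coordSub (g⁻¹.1 p) (g⁻¹.1 q) := rfl

theorem gen_smul_eq_self {v : OddVec n} {i : Fin n} (h : v.1 (rootLo i) = v.1 (rootHi i)) :
    gen n i • v = v := by
  refine Subtype.ext (funext fun p => ?_)
  rw [OddVec.smul_apply, gen_inv, gen_apply]
  split_ifs <;> simp_all [apply_neg]

theorem coordSub_ofNat (f : ℕ → ℤ) (i : Fin n) :
    coordSub (rootLo i) (rootHi i) (ofNat f) =
      if (i : ℕ) = 0 then f 1 + f 2 else f (i + 1) - f i := by
  simp only [coordSub_apply, ofNat, rootLo, rootHi]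
  split_ifs with h
  · change 1 * f 2 - -1 * f 1 = _
    ring
  · rw [Int.sign_eq_one_of_pos (by omega), Int.sign_eq_one_of_pos (by omega),
      show ((i : ℤ) + 1).natAbs = i + 1 by omega, Int.natAbs_natCast, one_mul, one_mul]

/-- The additive monoid generated by the simple roots of type `D`. -/
def simpleRootCone (n : ℕ) [n.AtLeastTwo] : AddSubmonoid (OddVec n →+ ℤ) :=
  AddSubmonoid.closure (Set.range fun i => coordSub (rootLo i) (rootHi i))

theorem coordSub_mem_simpleRootCone (i : Fin n) :
    coordSub (rootLo i) (rootHi i) ∈ simpleRootCone n := AddSubmonoid.subset_closure ⟨i, rfl⟩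

theorem coordSub_mem_simpleRootCone_of_pos {p q : SignedPoint n} (hp : 0 < p.1) (hpq : p ≤ q) :
    coordSub p q ∈ simpleRootCone n := by
  induction h : (q.1 - p.1).toNat generalizing p with
  | zero =>
    obtain rfl : p = q := le_antisymm hpq (Subtype.coe_le_coe.1 (by omega))
    rw [coordSub_self]
    exact zero_mem _
  | succ d ih =>
    have hq := q.2
    let i : Fin n := ⟨p.1.toNat, by omega⟩
    have hlo : rootLo i = p := Subtype.ext (by simp only [rootLo, i]; split_ifs <;> omega)
    have hhi : (rootHi i).1 = p.1 + 1 := by simp only [rootHi, i]; split_ifs <;> omega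
    rw [← coordSub_add_coordSub p (rootHi i) q]
    refine add_mem ?_ (ih (by omega) (Subtype.coe_le_coe.1 (by omega)) (by omega))
    conv in coordSub p _ => rw [← hlo]
    exact coordSub_mem_simpleRootCone i

theorem coordSub_mem_simpleRootCone_of_add_pos {p q : SignedPoint n} (hpq : p < q)
    (h : 0 < p.1 + q.1) : coordSub p q ∈ simpleRootCone n := by
  have hq := q.2
  rw [← Subtype.coe_lt_coe] at hpq
  rcases lt_or_gt_of_ne p.2.1 with hp | hp
  · have hn := hn.prop
    let i : Fin n := ⟨0, by omega⟩
    rw [← coordSub_add_coordSub p (rootLo i) q, ← coordSub_add_coordSub (rootLo i) (rootHi i) q,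
      ← coordSub_neg_neg p (rootLo i)]
    exact add_mem (coordSub_mem_simpleRootCone_of_pos one_pos (Subtype.coe_le_coe.1 (by
      simp only [rootLo, i, val_neg, if_true]; omega)))
      (add_mem (coordSub_mem_simpleRootCone i)
        (coordSub_mem_simpleRootCone_of_pos two_pos (Subtype.coe_le_coe.1 (by
          simp only [rootHi, i, if_true]; omega))))
  · exact coordSub_mem_simpleRootCone_of_pos hp (Subtype.coe_le_coe.1 hpq.le)

theorem PosPair.coordSub_mem_simpleRootCone {p q : SignedPoint n} (h : PosPair p q) :
    coordSub p q ∈ simpleRootCone n := by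
  obtain ⟨hlt, hne⟩ := h
  have hsum : p.1 + q.1 ≠ 0 := fun hsum => hne (Subtype.ext (by rw [val_neg]; omega))
  rcases lt_or_gt_of_ne hsum with hneg | hpos
  · rw [← coordSub_neg_neg]
    refine coordSub_mem_simpleRootCone_of_add_pos ?_ ?_
    · rw [← Subtype.coe_lt_coe] at hlt ⊢
      exact neg_lt_neg hlt
    · simp only [val_neg]; omega
  · exact coordSub_mem_simpleRootCone_of_add_pos hlt hpos

end TypeD

/-! ### Signs and membership in `D_n` -/

section SignProd

variable {n : ℕ}

/-- The product of the signs of the coordinates, which tells `D_n` apart from the group of all odd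
permutations of the signed points. -/
def signProd (v : SignedPoint n → ℤ) : ℤ := ∏ i : Fin n, (v (coord i)).sign

theorem sign_apply_of_odd {v : SignedPoint n → ℤ} (hv : v.Odd) (p : SignedPoint n) :
    (v p).sign = p.1.sign * (v (coord (index p))).sign := by
  rcases eq_coord_index_or p with ⟨hp, h⟩ | ⟨hp, h⟩
  · rw [Int.sign_eq_one_of_pos hp, one_mul, ← h]
  · rw [Int.sign_eq_neg_one_of_neg hp, neg_one_mul, ← Int.sign_neg, ← hv, ← h]

theorem signProd_comp {v : SignedPoint n → ℤ} (hv : v.Odd) {g : SignedPoint n → SignedPoint n}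
    (hg : g.Odd) (hg' : g.Injective) :
    signProd (fun p => v (g p)) = signProd (fun p => (g p).1) * signProd v := by
  simp only [signProd, sign_apply_of_odd hv (g _), Finset.prod_mul_distrib]
  rw [(Finite.injective_iff_bijective.1 (index_apply_coord_injective hg hg')).prod_comp
    fun i => (v (coord i)).sign]

theorem signProd_val : signProd (Subtype.val : SignedPoint n → ℤ) = 1 :=
  Finset.prod_eq_one fun i _ => Int.sign_eq_one_of_pos (by rw [val_coord]; omega)

end SignProd

section TypeD

variable {n : ℕ} [hn : n.AtLeastTwo]

theorem signProd_gen (i : Fin n) : signProd (fun p => ((gen n i).1 p).1) = 1 := by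
  have hn := hn.prop
  by_cases hi : (i : ℕ) = 0
  · rw [signProd, Fintype.prod_eq_mul (⟨0, by omega⟩ : Fin n) ⟨1, by omega⟩ (by simp)]
    · have hzero : ((gen n i).1 (coord ⟨0, by omega⟩)).1 = -2 := by
        simp [gen_apply, Subtype.ext_iff, rootLo, rootHi, hi]
      have hone : ((gen n i).1 (coord ⟨1, by omega⟩)).1 = -1 := by
        simp [gen_apply, Subtype.ext_iff, rootLo, rootHi, hi]
      rw [hzero, hone]
      rfl
    · intro j hj
      simp only [Ne, Fin.ext_iff] at hj
      refine Int.sign_eq_one_of_pos ?_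
      simp only [gen_apply, Subtype.ext_iff, rootLo, rootHi, val_neg, val_coord, hi,
        apply_ite Subtype.val, if_true]
      split_ifs <;> omega
  · refine Finset.prod_eq_one fun j _ => Int.sign_eq_one_of_pos ?_
    simp only [gen_apply, Subtype.ext_iff, rootLo, rootHi, val_neg, val_coord, hi,
      apply_ite Subtype.val, if_false]
    split_ifs <;> omega

theorem signProd_of_mem_DGroup {g : Equiv.Perm (SignedPoint n)} (hg : g ∈ DGroup n) :
    signProd (fun p => (g p).1) = 1 := by
  induction hg using Subgroup.closure_induction with
  | mem x hx => obtain ⟨i, rfl⟩ := hx; exact signProd_gen i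
  | one => exact signProd_val
  | mul x y hx hy hx' hy' =>
    have h := signProd_comp (v := fun p => (x p).1)
      (fun p => congrArg Subtype.val (odd_of_mem_DGroup hx p)) (odd_of_mem_DGroup hy) y.injective
    rwa [hx', hy'] at h
  | inv x hx hx' =>
    have h := signProd_comp (v := fun p => (x p).1)
      (fun p => congrArg Subtype.val (odd_of_mem_DGroup hx p))
      (odd_of_mem_DGroup (inv_mem hx)) x⁻¹.injective
    rw [hx', mul_one] at h
    rw [← h, ← signProd_val]
    exact congrArg signProd (funext fun p => congrArg Subtype.val (x.apply_symm_apply p))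

theorem signProd_smul (g : DGroup n) (v : OddVec n) : signProd (g • v).1 = signProd v.1 := by
  have h := signProd_comp v.2 (odd_of_mem_DGroup g⁻¹.2) g⁻¹.1.injective
  rwa [signProd_of_mem_DGroup g⁻¹.2, one_mul] at h

theorem signProd_eq_neg_one_of_posPair {g : Equiv.Perm (SignedPoint n)} (hg : Function.Odd g)
    (hmono : ∀ p q, PosPair p q → g p < g q)
    (h : g (coord ⟨0, by have := hn.prop; omega⟩) < g (-coord ⟨0, by have := hn.prop; omega⟩)) :
    signProd (fun p => (g p).1) = -1 := by
  set p₀ : SignedPoint n := coord ⟨0, by have := hn.prop; omega⟩ with hp₀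
  rw [hg, ← Subtype.coe_lt_coe, val_neg] at h
  rw [signProd, Fintype.prod_eq_single ⟨0, by have := hn.prop; omega⟩]
  · exact Int.sign_eq_neg_one_of_neg (by rw [← hp₀]; omega)
  · intro i hi
    have hi : (i : ℕ) ≠ 0 := fun h => hi (Fin.ext h)
    refine Int.sign_eq_one_of_pos ?_
    have hpos := hmono p₀ (coord i) (by
      simp only [PosPair, ← Subtype.coe_lt_coe, Ne, Subtype.ext_iff, val_neg, val_coord, hp₀]
      omega)
    have hneg := hmono (-p₀) (coord i) (by
      simp only [PosPair, ← Subtype.coe_lt_coe, Ne, Subtype.ext_iff, val_neg, val_coord, hp₀]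
      omega)
    rw [← Subtype.coe_lt_coe] at hpos hneg
    rw [hg, val_neg] at hneg
    omega

theorem strictMono_of_posPair {g : Equiv.Perm (SignedPoint n)}
    (hmono : ∀ p q, PosPair p q → g p < g q)
    (h : g (-coord ⟨0, by have := hn.prop; omega⟩) < g (coord ⟨0, by have := hn.prop; omega⟩)) :
    StrictMono g := by
  intro p q hpq
  by_cases hq : q = -p
  · subst hq
    rw [← Subtype.coe_lt_coe, val_neg] at hpq
    by_cases hp : p = -coord ⟨0, by have := hn.prop; omega⟩
    · rwa [hp, neg_neg]
    · have hp : p.1 ≠ -1 := fun h => hp (Subtype.ext (by rw [h, val_neg, val_coord]; rfl))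
      refine (hmono _ _ ?_).trans (h.trans (hmono _ _ ?_)) <;>
      · simp only [PosPair, ← Subtype.coe_lt_coe, Ne, Subtype.ext_iff, val_neg, val_coord]
        omega
  · exact hmono p q ⟨hpq, hq⟩

theorem eq_one_of_posPair {g : Equiv.Perm (SignedPoint n)} (hg : Function.Odd g)
    (hmono : ∀ p q, PosPair p q → g p < g q) (hsign : signProd (fun p => (g p).1) = 1) : g = 1 := by
  rcases lt_or_gt_of_ne (g.injective.ne (ne_neg_self (coord ⟨0, by have := hn.prop; omega⟩)))
    with h | h
  · rw [signProd_eq_neg_one_of_posPair hg hmono h] at hsign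
    exact absurd hsign (by decide)
  · have hiso : (strictMono_of_posPair hmono h).orderIsoOfSurjective g g.surjective =
        OrderIso.refl _ := Subsingleton.elim _ _
    exact Equiv.ext fun p => DFunLike.congr_fun hiso p

end TypeD

/-! ### The simple system of type `D` -/

section TypeD

variable {n : ℕ}

/-- The vector with coordinates `1, …, n`, which lies on no reflecting hyperplane. -/
def OddVec.val (n : ℕ) : OddVec n := ⟨Subtype.val, fun _ => rfl⟩

theorem finite_setOf_posPair :
    {α : OddVec n →+ ℤ | ∃ p q, PosPair p q ∧ coordSub p q = α}.Finite :=
  ((Set.toFinite {x : SignedPoint n × SignedPoint n | PosPair x.1 x.2}).image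
    fun x => coordSub x.1 x.2).subset fun _ ⟨p, q, h, e⟩ => ⟨(p, q), h, e⟩

/-- A vector that vanishes on all simple roots of type `D` except the `i`-th one. -/
def OddVec.weight (i : Fin n) : OddVec n :=
  ofNat fun x => if x ≤ i then if (i : ℕ) = 1 then -1 else 0 else 1

variable [hn : n.AtLeastTwo]

theorem coordSub_weight_self (i : Fin n) : 0 < coordSub (rootLo i) (rootHi i) (weight i) := by
  rw [weight, coordSub_ofNat]
  split_ifs <;> omega

theorem coordSub_weight_of_ne {i j : Fin n} (h : i ≠ j) :
    coordSub (rootLo i) (rootHi i) (weight j) = 0 := by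
  rw [Ne, Fin.ext_iff] at h
  rw [weight, coordSub_ofNat]
  split_ifs <;> omega

variable (n) in
/-- The simple system of type `D` on `ℤ ^ n`. Its simple roots are `x₁ + x₂` for the generator
`s_{1'}` and `x_{i+1} - x_i` for the generator `s_i`. -/
noncomputable def dSystem : SimpleSystem (DGroup n) (OddVec n) (Fin n) where
  posRoots := (finite_setOf_posPair (n := n)).toFinset
  simpleRoot i := coordSub (rootLo i) (rootHi i)
  reflection := gen n
  weight := weight
  zero_notMem h := by
    obtain ⟨p, q, hpq, hzero⟩ := (Set.Finite.mem_toFinset _).1 h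
    have hval : q.1 - p.1 = 0 := DFunLike.congr_fun hzero (OddVec.val n)
    exact hpq.1.ne' (Subtype.ext (sub_eq_zero.1 hval))
  simpleRoot_mem i := (Set.Finite.mem_toFinset _).2 ⟨_, _, posPair_rootLo_rootHi i, rfl⟩
  mem_closure_simpleRoot α hα := by
    obtain ⟨p, q, hpq, rfl⟩ := (Set.Finite.mem_toFinset _).1 hα
    exact hpq.coordSub_mem_simpleRootCone
  simpleRoot_weight_self := coordSub_weight_self
  simpleRoot_weight_of_ne _ _ := coordSub_weight_of_ne
  reflection_mul_self := gen_mul_gen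
  reflection_smul_simpleRoot i := by
    rw [mk_smul_coordSub, gen_inv, gen_apply_rootLo, gen_apply_rootHi, neg_coordSub]
  reflection_smul_mem i α hα hne := by
    obtain ⟨p, q, hpq, rfl⟩ := (Set.Finite.mem_toFinset _).1 hα
    rw [mk_smul_coordSub, gen_inv]
    rcases hpq.gen_apply i with h | ⟨rfl, rfl⟩ | ⟨rfl, rfl⟩
    · exact (Set.Finite.mem_toFinset _).2 ⟨_, _, h, rfl⟩
    · exact absurd rfl hne
    · exact absurd (coordSub_neg_neg _ _) hne
  reflection_smul_eq_self i v h := gen_smul_eq_self (sub_eq_zero.1 h).symm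
  closure_reflection := by
    convert Subgroup.closure_closure_coe_preimage (k := Set.range (permGen n)) using 2
    ext g
    exact exists_congr fun i => Subtype.ext_iff
  eq_one_of_smul_mem g hg := by
    refine inv_eq_one.1 (Subtype.ext (eq_one_of_posPair (odd_of_mem_DGroup g⁻¹.2) ?_
      (signProd_of_mem_DGroup g⁻¹.2)))
    intro p q hpq
    obtain ⟨p', q', hpq', h⟩ :=
      (Set.Finite.mem_toFinset _).1 (hg _ ((Set.Finite.mem_toFinset _).2 ⟨p, q, hpq, rfl⟩))
    rw [mk_smul_coordSub] at h
    have hval : q'.1 - p'.1 = (g⁻¹.1 q).1 - (g⁻¹.1 p).1 :=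
      DFunLike.congr_fun h (OddVec.val n)
    have hlt := Subtype.coe_lt_coe.2 hpq'.1
    exact Subtype.coe_lt_coe.1 (by omega)

theorem PosPair.coordSub_mem_posRoots {p q : SignedPoint n} (h : PosPair p q) :
    coordSub p q ∈ (dSystem n).posRoots := (Set.Finite.mem_toFinset _).2 ⟨p, q, h, rfl⟩

theorem mem_dSystem_roots {α : OddVec n →+ ℤ} :
    α ∈ (dSystem n).roots ↔ ∃ p q, p ≠ q ∧ q ≠ -p ∧ coordSub p q = α := by
  rw [SimpleSystem.mem_roots]
  constructor
  · rintro (h | h) <;> obtain ⟨p, q, hpq, h⟩ := (Set.Finite.mem_toFinset _).1 h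
    · exact ⟨p, q, hpq.1.ne, hpq.2, h⟩
    · exact ⟨q, p, hpq.1.ne', fun e => hpq.2 (neg_eq_iff_eq_neg.1 e.symm),
        by rw [← neg_coordSub, h, neg_neg]⟩
  · rintro ⟨p, q, hne, hne', rfl⟩
    rcases lt_or_gt_of_ne hne with h | h
    · exact Or.inl (PosPair.coordSub_mem_posRoots ⟨h, hne'⟩)
    · rw [neg_coordSub]
      exact Or.inr (PosPair.coordSub_mem_posRoots ⟨h, fun e => hne' (neg_eq_iff_eq_neg.1 e.symm)⟩)

theorem zeroSet_eq_zeroSet_iff {v u : OddVec n} :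
    (dSystem n).zeroSet v = (dSystem n).zeroSet u ↔
      ∀ p q, q ≠ -p → (v.1 p = v.1 q ↔ u.1 p = u.1 q) := by
  simp only [Finset.ext_iff, SimpleSystem.mem_zeroSet, mem_dSystem_roots]
  constructor
  · intro h p q hpq
    by_cases hne : p = q
    · simp only [hne]
    · have hroot := h (coordSub p q)
      rw [and_congr_right_iff] at hroot
      have := hroot ⟨p, q, hne, hpq, rfl⟩
      rwa [coordSub_apply, coordSub_apply, sub_eq_zero, sub_eq_zero, eq_comm, eq_comm (a := u.1 q)]
        at this
  · intro h α
    refine and_congr_right ?_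
    rintro ⟨p, q, -, hpq, rfl⟩
    rw [coordSub_apply, coordSub_apply, sub_eq_zero, sub_eq_zero, eq_comm, h p q hpq, eq_comm]

theorem mem_DGroup_of_signProd {g : Equiv.Perm (SignedPoint n)} (hg : Function.Odd g)
    (hsign : signProd (fun p => (g p).1) = 1) : g ∈ DGroup n := by
  have hg' : Function.Odd fun p => (g p).1 := fun p => congrArg Subtype.val (hg p)
  obtain ⟨h, hdom⟩ := (dSystem n).exists_isDominant_smul ⟨fun p => (g p).1, hg'⟩
  have hmono : ∀ p q, PosPair p q → (g * h⁻¹.1) p < (g * h⁻¹.1) q := fun p q hpq => by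
    have hle := sub_nonneg.1 (hdom _ hpq.coordSub_mem_posRoots)
    exact lt_of_le_of_ne (Subtype.coe_le_coe.1 hle) ((g * h⁻¹.1).injective.ne hpq.1.ne)
  have hone : g * h⁻¹.1 = 1 :=
    eq_one_of_posPair (hg.comp_odd (odd_of_mem_DGroup h⁻¹.2)) hmono
      ((signProd_smul h ⟨_, hg'⟩).trans hsign)
  rw [eq_inv_of_mul_eq_one_left hone]
  exact inv_mem h⁻¹.2

end TypeD

/-! ### Conjugacy of flats in type `D` -/

open scoped Finset

/-- A permutation of the index set carries the level sets of `f` to those of `g`, and the zeros of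
`f` to the zeros of `g`. -/
def SameShape {ι : Type*} (f g : ι → ℕ) : Prop :=
  ∃ π : Equiv.Perm ι, (∀ i j, f i = f j ↔ g (π i) = g (π j)) ∧ ∀ i, f i = 0 ↔ g (π i) = 0

theorem SameShape.forall_ne_zero {ι : Type*} {f g : ι → ℕ} (h : SameShape f g)
    (hf : ∀ i, f i ≠ 0) (i : ι) : g i ≠ 0 := by
  obtain ⟨π, -, hzero⟩ := h
  rw [← π.apply_symm_apply i, Ne, ← hzero]
  exact hf _

/-- The value `0` is not attained exactly once. For the absolute values of the coordinates of a
vector this means that the roots of type `D` detect which coordinates vanish. -/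
def NoIsolatedZero {ι : Type*} (f : ι → ℕ) : Prop := ∀ i, f i = 0 → ∃ j ≠ i, f j = 0

theorem prod_eq_one_of_even_fibers {ι : Type*} [Fintype ι] {f : ι → ℕ} {s : ι → ℤ}
    (hs : ∀ i, s i * s i = 1) (hconst : ∀ i j, f i = f j → s i = s j)
    (heven : ∀ i, Even #{j | f j = f i}) : ∏ i, s i = 1 := by
  rw [← Finset.prod_fiberwise_of_maps_to (g := f) (t := Finset.univ.image f)
    fun i _ => Finset.mem_image_of_mem f (Finset.mem_univ i)]
  refine Finset.prod_eq_one fun c hc => ?_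
  obtain ⟨i, -, rfl⟩ := Finset.mem_image.1 hc
  obtain ⟨m, hm⟩ := heven i
  rw [Finset.prod_congr rfl fun j hj => hconst j i (Finset.mem_filter.1 hj).2, Finset.prod_const,
    hm, ← two_mul, pow_mul, pow_two, hs, one_pow]

namespace OddVec

variable {n : ℕ} {v u : OddVec n}

/-- The absolute values of the coordinates. -/
def absCoord (v : OddVec n) (i : Fin n) : ℕ := (v.1 (coord i)).natAbs

theorem absCoord_eq_zero {i : Fin n} : absCoord v i = 0 ↔ v.1 (coord i) = 0 := Int.natAbs_eq_zero

theorem absCoord_index (v : OddVec n) (p : SignedPoint n) :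
    absCoord v (index p) = (v.1 p).natAbs := by
  rcases eq_coord_index_or p with ⟨-, h⟩ | ⟨-, h⟩
  · rw [absCoord, ← h]
  · rw [absCoord, ← Int.natAbs_neg, ← apply_neg, ← h]

theorem isUnit_signProd (h : ∀ i, absCoord v i ≠ 0) : IsUnit (signProd v.1) :=
  IsUnit.prod_univ_iff.2 fun i => by
    rw [Int.isUnit_iff_natAbs_eq, Int.natAbs_sign_of_ne_zero (absCoord_eq_zero.not.1 (h i))]

theorem sign_unit_mul (e : ℤˣ) (a : ℤ) : (e * a : ℤ).sign = e * a.sign := by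
  rcases Int.units_eq_one_or e with rfl | rfl <;> simp

theorem exists_signedPerm (π : Equiv.Perm (Fin n)) (ε : Fin n → ℤˣ) :
    ∃ g : Equiv.Perm (SignedPoint n), Function.Odd g ∧
      ∀ (v : OddVec n) i, v.1 (g (coord i)) = ε i * v.1 (coord (π i)) := by
  let f (p : SignedPoint n) : SignedPoint n :=
    if 0 < p.1 * ε (index p) then coord (π (index p)) else -coord (π (index p))
  have hodd : f.Odd := fun p => by
    have hne : p.1 * ε (index p) ≠ 0 := mul_ne_zero p.2.1 (ε _).ne_zero
    simp only [f, index_neg, val_neg, neg_mul]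
    split_ifs <;> first | omega | simp
  have hindex (p) : index (f p) = π (index p) := by
    simp only [f]
    split_ifs <;> simp
  have hinj : f.Injective := fun p q h => by
    have hpq : index p = index q := π.injective (by rw [← hindex, ← hindex, h])
    rcases index_eq_index_iff.1 hpq with h' | rfl
    · exact h'
    · exact absurd ((hodd q).symm.trans h).symm (ne_neg_self _)
  refine ⟨Equiv.ofBijective f (Finite.injective_iff_bijective.1 hinj), hodd, fun v i => ?_⟩
  simp only [Equiv.ofBijective_apply, f, index_coord, val_coord]
  rcases Int.units_eq_one_or (ε i) with hi | hi <;> rw [hi]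
  · rw [if_pos (by rw [Units.val_one]; omega), Units.val_one, one_mul]
  · rw [if_neg (by rw [Units.val_neg, Units.val_one]; omega), Units.val_neg, Units.val_one,
      neg_one_mul, apply_neg]

theorem exists_signs (π : Equiv.Perm (Fin n))
    (hzero : ∀ i, absCoord v i = 0 ↔ absCoord u (π i) = 0)
    (hsign : (∃ i, absCoord v i = 0) ∨ signProd v.1 = signProd u.1) :
    ∃ ε : Fin n → ℤˣ, ∏ i, ε i = 1 ∧
      ∀ i, (v.1 (coord i)).sign = ε i * (u.1 (coord (π i))).sign := by
  have hex (i) : ∃ e : ℤˣ, (v.1 (coord i)).sign = e * (u.1 (coord (π i))).sign := by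
    have hi : (v.1 (coord i)).sign = 0 ↔ (u.1 (coord (π i))).sign = 0 := by
      simpa only [Int.sign_eq_zero_iff_zero, absCoord_eq_zero] using hzero i
    by_cases heq : (v.1 (coord i)).sign = (u.1 (coord (π i))).sign
    · exact ⟨1, by simpa using heq⟩
    · refine ⟨-1, ?_⟩
      have := Int.sign_trichotomy (v.1 (coord i))
      have := Int.sign_trichotomy (u.1 (coord (π i)))
      rw [Units.val_neg, Units.val_one]
      omega
  choose ε hε using hex
  by_cases hv : ∃ i, absCoord v i = 0
  · obtain ⟨i₀, hi₀⟩ := hv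
    refine ⟨ε * Pi.mulSingle i₀ (∏ i, ε i)⁻¹, ?_, fun i => ?_⟩
    · simp only [Pi.mul_apply, Finset.prod_mul_distrib, Finset.prod_pi_mulSingle', Finset.mem_univ,
        if_true, mul_inv_cancel]
    · rcases eq_or_ne i i₀ with rfl | hi
      · rw [absCoord_eq_zero.1 hi₀, absCoord_eq_zero.1 ((hzero i).1 hi₀), Int.sign_zero, mul_zero]
      · rw [Pi.mul_apply, Pi.mulSingle_eq_of_ne hi, mul_one, hε]
  · refine ⟨ε, Units.val_injective ?_, hε⟩
    have hprod : signProd v.1 = ↑(∏ i, ε i) * signProd u.1 := by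
      simp only [signProd, hε, Finset.prod_mul_distrib, Units.coe_prod]
      rw [Equiv.prod_comp π fun i => (u.1 (coord i)).sign]
    rw [← hsign.resolve_left hv] at hprod
    exact (mul_eq_right₀ (isUnit_signProd (not_exists.1 hv)).ne_zero).1 hprod.symm

theorem exists_signProd_eq_neg {c : ℕ}
    (hodd : Odd #{i | absCoord v i = c}) :
    ∃ w : OddVec n, absCoord w = absCoord v ∧ signProd w.1 = -signProd v.1 ∧
      ∀ p q, w.1 p = w.1 q ↔ v.1 p = v.1 q := by
  refine ⟨⟨fun p => if (v.1 p).natAbs = c then -v.1 p else v.1 p, fun p => ?_⟩, ?_, ?_, ?_⟩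
  · simp only [apply_neg, Int.natAbs_neg]
    split_ifs <;> rfl
  · funext i
    simp only [absCoord]
    split_ifs <;> simp
  · have hprod : ∏ i, (if absCoord v i = c then (-1 : ℤ) else 1) = -1 := by
      rw [Finset.prod_ite, Finset.prod_const, Finset.prod_const_one, mul_one, hodd.neg_one_pow]
    rw [← neg_one_mul, ← hprod]
    simp only [signProd, ← Finset.prod_mul_distrib]
    refine Finset.prod_congr rfl fun i _ => ?_
    change Int.sign (if absCoord v i = c then _ else _) = _
    split_ifs <;> simp
  · intro p q
    dsimp only
    split_ifs <;> omega

theorem apply_eq_apply_iff_of_sign_eq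
    (hsign : ∀ i, (v.1 (coord i)).sign = (u.1 (coord i)).sign)
    (habs : ∀ i j, absCoord v i = absCoord v j ↔ absCoord u i = absCoord u j)
    (p q : SignedPoint n) : v.1 p = v.1 q ↔ u.1 p = u.1 q := by
  have hsign' (p) : (v.1 p).sign = (u.1 p).sign := by
    rw [sign_apply_of_odd v.2, sign_apply_of_odd u.2, hsign]
  have heq_iff (a b : ℤ) : a = b ↔ a.sign = b.sign ∧ a.natAbs = b.natAbs :=
    ⟨fun h => h ▸ ⟨rfl, rfl⟩, fun h => by
      rw [← Int.sign_mul_natAbs a, h.1, h.2, Int.sign_mul_natAbs]⟩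
  rw [heq_iff, heq_iff (u.1 p), hsign', hsign', ← absCoord_index, ← absCoord_index, habs,
    absCoord_index, absCoord_index]

variable [hn : n.AtLeastTwo]

theorem exists_perm_absCoord_smul (g : DGroup n) :
    ∃ π : Equiv.Perm (Fin n), ∀ u i, absCoord (g • u) i = absCoord u (π i) := by
  have hinj := index_apply_coord_injective (odd_of_mem_DGroup g⁻¹.2) g⁻¹.1.injective
  exact ⟨Equiv.ofBijective _ (Finite.injective_iff_bijective.1 hinj), fun u i => by
    rw [Equiv.ofBijective_apply, absCoord_index, ← smul_apply, absCoord]⟩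

theorem coord_eq_iff_of_zeroSet_eq (h : (dSystem n).zeroSet v = (dSystem n).zeroSet u)
    {i j : Fin n} (hij : i ≠ j) :
    (v.1 (coord i) = v.1 (coord j) ↔ u.1 (coord i) = u.1 (coord j)) ∧
      (v.1 (coord i) = -v.1 (coord j) ↔ u.1 (coord i) = -u.1 (coord j)) := by
  rw [zeroSet_eq_zeroSet_iff] at h
  simp only [← apply_neg]
  exact ⟨h _ _ (coord_ne_neg_coord j i), h _ _ (neg_injective.ne (coord_injective.ne hij.symm))⟩

theorem absCoord_eq_iff_of_zeroSet_eq (h : (dSystem n).zeroSet v = (dSystem n).zeroSet u)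
    (i j : Fin n) : absCoord v i = absCoord v j ↔ absCoord u i = absCoord u j := by
  rcases eq_or_ne i j with rfl | hij
  · simp only
  · simp only [absCoord, Int.natAbs_eq_natAbs_iff]
    exact or_congr (coord_eq_iff_of_zeroSet_eq h hij).1 (coord_eq_iff_of_zeroSet_eq h hij).2

theorem absCoord_eq_zero_and_iff_of_zeroSet_eq
    (h : (dSystem n).zeroSet v = (dSystem n).zeroSet u) {i j : Fin n} (hij : i ≠ j) :
    absCoord v i = 0 ∧ absCoord v j = 0 ↔ absCoord u i = 0 ∧ absCoord u j = 0 := by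
  have := coord_eq_iff_of_zeroSet_eq h hij
  simp only [absCoord_eq_zero]
  omega

theorem sameShape_of_flatSetoid (hv : NoIsolatedZero (absCoord v))
    (hu : NoIsolatedZero (absCoord u)) (h : (dSystem n).flatSetoid v u) :
    SameShape (absCoord v) (absCoord u) := by
  obtain ⟨g, hg⟩ := h
  obtain ⟨π, hπ⟩ := exists_perm_absCoord_smul g
  refine ⟨π, fun i j => ?_, fun i => ⟨fun hi => ?_, fun hi => ?_⟩⟩
  · rw [absCoord_eq_iff_of_zeroSet_eq hg, hπ, hπ]
  · obtain ⟨j, hj, hvj⟩ := hv i hi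
    rw [← hπ]
    exact ((absCoord_eq_zero_and_iff_of_zeroSet_eq hg hj.symm).1 ⟨hi, hvj⟩).1
  · obtain ⟨j, hj, huj⟩ := hu (π i) hi
    obtain ⟨j, rfl⟩ := π.surjective j
    refine ((absCoord_eq_zero_and_iff_of_zeroSet_eq hg (π.injective.ne_iff.1 hj).symm).2 ?_).1
    rw [hπ, hπ]
    exact ⟨hi, huj⟩

theorem flatSetoid_of_sameShape (h : SameShape (absCoord v) (absCoord u))
    (hsign : (∃ i, absCoord v i = 0) ∨ signProd v.1 = signProd u.1) :
    (dSystem n).flatSetoid v u := by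
  obtain ⟨π, hπ, hzero⟩ := h
  obtain ⟨ε, hε, hsign⟩ := exists_signs π hzero hsign
  obtain ⟨g, hodd, hg⟩ := exists_signedPerm π ε
  have hmem : g ∈ DGroup n := by
    refine mem_DGroup_of_signProd hodd ?_
    have hcoord (i) : (g (coord i)).1.sign = ε i := by
      have hval : (g (coord i)).1 = ε i * (coord (π i)).1 := hg (OddVec.val n) i
      rw [hval, sign_unit_mul, Int.sign_eq_one_of_pos (by rw [val_coord]; omega), mul_one]
    simp only [signProd, hcoord]
    rw [← Units.coe_prod, hε, Units.val_one]
  refine ⟨⟨g, hmem⟩⁻¹, zeroSet_eq_zeroSet_iff.2 fun p q _ => ?_⟩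
  have hcoord (i) : ((⟨g, hmem⟩⁻¹ : DGroup n) • u).1 (coord i) = ε i * u.1 (coord (π i)) := by
    rw [smul_apply, inv_inv, hg]
  refine apply_eq_apply_iff_of_sign_eq (fun i => ?_) (fun i j => ?_) p q
  · rw [hsign, hcoord, sign_unit_mul]
  · rw [hπ]
    simp only [absCoord, hcoord, Int.natAbs_mul, Int.units_natAbs, one_mul]

theorem signProd_eq_of_zeroSet_eq (h : (dSystem n).zeroSet v = (dSystem n).zeroSet u)
    (hv : ∀ i, absCoord v i ≠ 0) (hu : ∀ i, absCoord u i ≠ 0)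
    (heven : ∀ i, Even #{j | absCoord v j = absCoord v i}) :
    signProd v.1 = signProd u.1 := by
  have hsign {a : ℤ} (ha : a ≠ 0) : a.sign * a.sign = 1 := by
    rw [← Int.sign_mul, Int.sign_eq_one_of_pos (mul_self_pos.2 ha)]
  refine Int.eq_of_mul_eq_one ?_
  rw [signProd, signProd, ← Finset.prod_mul_distrib]
  refine prod_eq_one_of_even_fibers (f := absCoord v) (fun i => ?_) (fun i j hij => ?_) heven
  · rw [mul_mul_mul_comm, hsign (absCoord_eq_zero.not.1 (hv i)),
      hsign (absCoord_eq_zero.not.1 (hu i)), one_mul]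
  · rcases eq_or_ne i j with rfl | hne
    · rfl
    obtain ⟨heq, hneg⟩ := coord_eq_iff_of_zeroSet_eq h hne
    rcases Int.natAbs_eq_natAbs_iff.1 hij with hv | hv
    · rw [hv, heq.1 hv]
    · rw [hv, hneg.1 hv, Int.sign_neg, Int.sign_neg, neg_mul_neg]

theorem flatSetoid_iff (hv : NoIsolatedZero (absCoord v)) (hu : NoIsolatedZero (absCoord u)) :
    (dSystem n).flatSetoid v u ↔ SameShape (absCoord v) (absCoord u) ∧
      ((∃ i, absCoord v i = 0) ∨
        (∃ i, Odd #{j | absCoord v j = absCoord v i}) ∨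
          signProd v.1 = signProd u.1) := by
  constructor
  · intro h
    have hshape := sameShape_of_flatSetoid hv hu h
    refine ⟨hshape, or_iff_not_imp_left.2 fun hzero => or_iff_not_imp_left.2 fun hodd => ?_⟩
    obtain ⟨g, hg⟩ := h
    obtain ⟨σ, hσ⟩ := exists_perm_absCoord_smul g
    have hu : ∀ i, absCoord u i ≠ 0 := hshape.forall_ne_zero (not_exists.1 hzero)
    rw [signProd_eq_of_zeroSet_eq hg (not_exists.1 hzero) (fun i => hσ u i ▸ hu _) fun i =>
      Nat.not_odd_iff_even.1 (not_exists.1 hodd i), signProd_smul]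
  · rintro ⟨h, hsign⟩
    by_cases hzero : (∃ i, absCoord v i = 0) ∨ signProd v.1 = signProd u.1
    · exact flatSetoid_of_sameShape h hzero
    obtain ⟨hv, hne⟩ := not_or.1 hzero
    obtain ⟨i, hodd⟩ := (hsign.resolve_left hv).resolve_right hne
    obtain ⟨w, habs, hw, hwv⟩ := exists_signProd_eq_neg hodd
    have hvw : (dSystem n).flatSetoid v w :=
      ⟨1, by rw [one_smul]; exact zeroSet_eq_zeroSet_iff.2 fun p q _ => (hwv p q).symm⟩
    refine (dSystem n).flatSetoid.trans hvw (flatSetoid_of_sameShape (habs ▸ h) (Or.inr ?_))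
    have hvunit := Int.isUnit_iff.1 (isUnit_signProd (not_exists.1 hv))
    have huunit := Int.isUnit_iff.1 (isUnit_signProd (h.forall_ne_zero (not_exists.1 hv)))
    omega

end OddVec

/-! ### Block decompositions of intervals -/

/-- The points after which a block starts, if blocks of sizes `l` follow the points `1, …, d`. -/
def blockStarts (d : ℕ) (l : List ℕ) : Set ℕ := {x | ∃ j < l.length, d + (l.take j).sum = x}

theorem blockStarts_nil (d : ℕ) : blockStarts d [] = ∅ := by simp [blockStarts]

theorem blockStarts_cons (d a : ℕ) (l : List ℕ) :
    blockStarts d (a :: l) = insert d (blockStarts (d + a) l) := by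
  ext x
  constructor
  · rintro ⟨j | j, hj, rfl⟩
    · exact Or.inl rfl
    · exact Or.inr ⟨j, Nat.lt_of_succ_lt_succ hj, by simp [add_assoc]⟩
  · rintro (rfl | ⟨j, hj, rfl⟩)
    · exact ⟨0, Nat.succ_pos _, rfl⟩
    · exact ⟨j + 1, Nat.succ_lt_succ hj, by simp [add_assoc]⟩

theorem exists_blockStarts_eq {n : ℕ} (B : Finset ℕ) (hB : ∀ x ∈ B, x < n) :
    ∃ l : List ℕ, (∀ a ∈ l, 0 < a) ∧ l.sum ≤ n ∧ blockStarts (n - l.sum) l = B := by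
  induction B using Finset.induction_on_min with
  | empty => exact ⟨[], by simp, by simp, by simp [blockStarts_nil]⟩
  | insert b B hb ih =>
    obtain ⟨l, hpos, hsum, hl⟩ := ih fun x hx => hB x (Finset.mem_insert_of_mem hx)
    have hlt : b < n - l.sum := by
      rcases l with - | ⟨a, l⟩
      · simpa using hB b (Finset.mem_insert_self b B)
      · have hmem : n - (a :: l).sum ∈ (B : Set ℕ) := by
          rw [← hl, blockStarts_cons]
          exact Set.mem_insert _ _
        exact hb _ hmem
    refine ⟨(n - l.sum - b) :: l, List.forall_mem_cons.2 ⟨by omega, hpos⟩, ?_, ?_⟩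
    · rw [List.sum_cons]; omega
    · rw [blockStarts_cons, List.sum_cons, show n - (n - l.sum - b + l.sum) = b by omega,
        show b + (n - l.sum - b) = n - l.sum by omega, hl, Finset.coe_insert]

/-- With blocks of sizes `l` following the points `1, …, d`, the number of the block that
contains `x`, counted from `1`; it is `0` if `x ≤ d`. -/
def blockLevel : ℕ → List ℕ → ℕ → ℕ
  | _, [], _ => 0
  | d, a :: l, x => if d < x then blockLevel (d + a) l x + 1 else 0

theorem lt_blockLevel_iff {d : ℕ} {l : List ℕ} {x j : ℕ} :
    j < blockLevel d l x ↔ j < l.length ∧ d + (l.take j).sum < x := by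
  induction l generalizing d j with
  | nil => simp [blockLevel]
  | cons a l ih =>
    rw [blockLevel]
    cases j with
    | zero => split_ifs with h <;> simp [h]
    | succ j =>
      split_ifs with h
      · rw [Nat.add_lt_add_iff_right, ih]
        simp [add_assoc]
      · simp only [List.take_succ_cons, List.sum_cons]
        omega

theorem blockLevel_le_length (d : ℕ) (l : List ℕ) (x : ℕ) : blockLevel d l x ≤ l.length :=
  le_of_not_gt fun h => lt_irrefl _ (lt_blockLevel_iff.1 h).1

theorem blockLevel_mono (d : ℕ) (l : List ℕ) : Monotone (blockLevel d l) := by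
  intro x y hxy
  refine le_of_forall_lt fun j hj => lt_blockLevel_iff.2 ?_
  have hlt := lt_blockLevel_iff.1 hj
  exact ⟨hlt.1, hlt.2.trans_le hxy⟩

theorem blockLevel_succ_eq_iff {d : ℕ} {l : List ℕ} {x : ℕ} :
    blockLevel d l (x + 1) = blockLevel d l x ↔ x ∉ blockStarts d l := by
  constructor
  · rintro h ⟨j, hj, hx⟩
    have hlt : j < blockLevel d l (x + 1) := lt_blockLevel_iff.2 ⟨hj, by omega⟩
    rw [h, lt_blockLevel_iff] at hlt
    omega
  · intro h
    refine le_antisymm (le_of_forall_lt fun j hj => lt_blockLevel_iff.2 ?_)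
      (blockLevel_mono d l (Nat.le_succ x))
    obtain ⟨hj, hlt⟩ := lt_blockLevel_iff.1 hj
    exact ⟨hj, lt_of_le_of_ne (Nat.le_of_lt_succ hlt) fun e => h ⟨j, hj, e⟩⟩

theorem blockLevel_eq_zero_iff {d : ℕ} {l : List ℕ} {x : ℕ} (hx : x ≤ d + l.sum) :
    blockLevel d l x = 0 ↔ x ≤ d := by
  rw [← Nat.le_zero, ← not_lt, lt_blockLevel_iff, List.length_pos_iff]
  rcases l with - | ⟨a, l⟩
  · simpa using hx
  · simp

theorem blockLevel_eq_succ_iff {d : ℕ} {l : List ℕ} {x j : ℕ} (hj : j < l.length)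
    (hx : x ≤ d + l.sum) :
    blockLevel d l x = j + 1 ↔ d + (l.take j).sum < x ∧ x ≤ d + (l.take j).sum + l[j] := by
  have hlevel : blockLevel d l x = j + 1 ↔ j < blockLevel d l x ∧ ¬ j + 1 < blockLevel d l x := by
    omega
  rw [hlevel, lt_blockLevel_iff, lt_blockLevel_iff, add_assoc, ← List.sum_take_succ l j hj]
  rcases lt_or_ge (j + 1) l.length with hlt | hge
  · omega
  · rw [List.take_of_length_le hge]
    omega

theorem card_blockLevel_eq_succ {n d : ℕ} {l : List ℕ} (hn : d + l.sum = n) {j : ℕ}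
    (hj : j < l.length) :
    #{i : Fin n | blockLevel d l (i + 1) = j + 1} = l[j] := by
  have hle : (l.take (j + 1)).sum ≤ l.sum :=
    (List.take_sublist (j + 1) l).sum_le_sum fun _ _ => Nat.zero_le _
  rw [List.sum_take_succ l j hj] at hle
  have hfilter : (Finset.univ.filter fun i : Fin n => blockLevel d l (i + 1) = j + 1) =
      Finset.univ.filter fun i : Fin n =>
        d + (l.take j).sum ≤ i ∧ (i : ℕ) < d + (l.take j).sum + l[j] := by
    refine Finset.filter_congr fun i _ => ?_
    rw [blockLevel_eq_succ_iff hj (by omega)]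
    omega
  have hmap : (Finset.univ.filter fun i : Fin n =>
      d + (l.take j).sum ≤ i ∧ (i : ℕ) < d + (l.take j).sum + l[j]).map Fin.valEmbedding =
        Finset.Ico (d + (l.take j).sum) (d + (l.take j).sum + l[j]) := by
    ext x
    simp only [Finset.mem_map, Finset.mem_filter, Finset.mem_univ, true_and, Fin.valEmbedding_apply,
      Finset.mem_Ico]
    exact ⟨fun ⟨_, hi, e⟩ => e ▸ hi, fun hx => ⟨⟨x, by omega⟩, hx, rfl⟩⟩
  rw [hfilter, ← Finset.card_map Fin.valEmbedding, hmap, Nat.card_Ico, Nat.add_sub_cancel_left]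

theorem card_blockLevel_eq_zero {n d : ℕ} {l : List ℕ} (hn : d + l.sum = n) :
    #{i : Fin n | blockLevel d l (i + 1) = 0} = d := by
  have hfilter : (Finset.univ.filter fun i : Fin n => blockLevel d l (i + 1) = 0) =
      Finset.univ.filter fun i : Fin n => (i : ℕ) < d :=
    Finset.filter_congr fun i _ => by rw [blockLevel_eq_zero_iff (by omega), Nat.succ_le_iff]
  rw [hfilter, Fin.card_filter_val_lt, min_eq_right (by omega)]

namespace DComp

variable {n : ℕ}

/-- The number of points before the first block. -/
def offset (κ : DComp n) : ℕ := n - κ.components.sum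

theorem components_pos (κ : DComp n) : ∀ a ∈ κ.components, 0 < a := by
  cases κ <;> exact fun a ha => Composition.blocks_pos _ ha

theorem offset_add_sum (κ : DComp n) : κ.offset + κ.components.sum = n := by
  cases κ <;> simp only [offset, components, Composition.blocks_sum] <;> omega

theorem offset_ne_one (κ : DComp n) : κ.offset ≠ 1 := by
  cases κ <;> simp only [offset, components, Composition.blocks_sum] <;> omega

theorem InFull.offset_eq_zero {κ : DComp n} (h : κ.InFull) : κ.offset = 0 := by
  cases κ <;> simp_all [InFull, components, offset]

theorem InFull.not_inFullPrime {κ : DComp n} (h : κ.InFull) : ¬ κ.InFullPrime := by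
  cases κ <;> simp_all [InFull, InFullPrime]

theorem InFullPrime.offset_eq_zero {κ : DComp n} (h : κ.InFullPrime) : κ.offset = 0 := by
  cases κ <;> simp_all [InFullPrime, components, offset]

/-- The points after which a component starts. -/
def starts (κ : DComp n) : Set ℕ := blockStarts κ.offset κ.components

theorem zero_mem_starts_iff [hn : n.AtLeastTwo] (κ : DComp n) :
    0 ∈ κ.starts ↔ κ.offset = 0 := by
  have hsum := κ.offset_add_sum
  have hn := hn.prop
  constructor
  · rintro ⟨j, -, h⟩
    omega
  · refine fun h => ⟨0, List.length_pos_iff.2 fun e => ?_, by simpa using h⟩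
    rw [e, List.sum_nil] at hsum
    omega

theorem InFullPrime.one_notMem_starts {κ : DComp n} (h : κ.InFullPrime) : 1 ∉ κ.starts := by
  cases κ with
  | below | one | full => exact absurd h id
  | fullPrime c hc =>
    obtain ⟨a, ha, hhead⟩ := hc
    obtain ⟨l, hl⟩ := List.head?_eq_some_iff.1 hhead
    rintro ⟨j | j, -, hsum⟩
    · rw [h.offset_eq_zero, List.take_zero, List.sum_nil] at hsum
      omega
    · simp only [components, hl, List.take_succ_cons, List.sum_cons] at hsum
      omega

theorem mem_indexSet_iff {κ : DComp n} (h : ¬ κ.InFullPrime) {i : Fin n} :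
    i ∈ κ.indexSet ↔ (i : ℕ) ∈ κ.starts := by
  have hn : 0 < n := i.pos
  cases κ with
  | below m hm c =>
    simp [indexSet, starts, blockStarts, components, offset, Composition.sizeUpTo, eq_comm]
  | one c hc | full c hc =>
    have hlength : 0 < c.length := c.length_pos_of_pos hn
    simp only [indexSet, starts, blockStarts, components, offset, Composition.sizeUpTo,
      Set.mem_ofPred_eq, Composition.blocks_sum, Nat.sub_self, zero_add, Composition.blocks_length]
    constructor
    · rintro (h | ⟨j, -, hj, h⟩)
      · exact ⟨0, hlength, by simp [h]⟩
      · exact ⟨j, hj, h.symm⟩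
    · rintro ⟨j, hj, h⟩
      rcases Nat.eq_zero_or_pos j with rfl | hpos
      · exact Or.inl (by simpa using h.symm)
      · exact Or.inr ⟨j, hpos, hj, h.symm⟩
  | fullPrime c hc => exact absurd trivial h

theorem InFullPrime.mem_indexSet_iff {κ : DComp n} (h : κ.InFullPrime) {i : Fin n} :
    i ∈ κ.indexSet ↔ (i : ℕ) = 1 ∨ (i : ℕ) ≠ 0 ∧ (i : ℕ) ∈ κ.starts := by
  cases κ with
  | below | one | full => exact absurd h id
  | fullPrime c hc =>
    simp only [indexSet, starts, blockStarts, components, offset, Composition.sizeUpTo,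
      Set.mem_ofPred_eq, Composition.blocks_sum, Nat.sub_self, zero_add, Composition.blocks_length]
    refine or_congr_right ⟨?_, ?_⟩
    · rintro ⟨j, hpos, hj, h⟩
      refine ⟨fun h0 => ?_, j, hj, h.symm⟩
      have hlt := (c.sizeUpTo_strict_mono (i := 0) (by omega)).trans_le (c.monotone_sizeUpTo hpos)
      rw [c.sizeUpTo_zero, Composition.sizeUpTo, ← h] at hlt
      omega
    · rintro ⟨h0, j, hj, h⟩
      refine ⟨j, Nat.pos_of_ne_zero ?_, hj, h.symm⟩
      rintro rfl
      exact h0 (by simpa using h.symm)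

theorem exists_components_eq {l : List ℕ} (hpos : ∀ a ∈ l, 0 < a) (hsum : l.sum ≤ n)
    (hn : 0 < n) (hone : n - l.sum ≠ 1) : ∃ κ : DComp n, ¬ κ.InFullPrime ∧ κ.components = l := by
  rcases hsum.eq_or_lt with rfl | hlt
  · rcases l with - | ⟨a, l⟩
    · simp at hn
    rcases eq_or_ne a 1 with rfl | ha
    · exact ⟨one ⟨1 :: l, hpos _, rfl⟩ rfl, id, rfl⟩
    · have := hpos a List.mem_cons_self
      exact ⟨full ⟨a :: l, hpos _, rfl⟩ ⟨a, by omega, rfl⟩, id, rfl⟩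
  · exact ⟨below l.sum (by omega) ⟨l, hpos _, rfl⟩, id, rfl⟩

theorem exists_inFullPrime_components_eq {l : List ℕ} (hpos : ∀ a ∈ l, 0 < a) (hsum : l.sum = n)
    (hn : 2 ≤ n) (hone : 1 ∉ blockStarts 0 l) :
    ∃ κ : DComp n, κ.InFullPrime ∧ κ.components = l := by
  subst hsum
  rcases l with - | ⟨a, l⟩
  · simp at hn
  have ha : a ≠ 1 := by
    rintro rfl
    refine hone ⟨1, ?_, by simp⟩
    rcases l with - | ⟨b, l⟩
    · simp at hn
    · simp
  have := hpos a List.mem_cons_self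
  exact ⟨fullPrime ⟨a :: l, hpos _, rfl⟩ ⟨a, by omega, rfl⟩, trivial, rfl⟩

end DComp

theorem exists_perm_succ (e : Equiv.Perm ℕ) :
    ∃ e' : Equiv.Perm ℕ, e' 0 = 0 ∧ ∀ c, e' (c + 1) = e c + 1 :=
  ⟨e.extendDomain Equiv.pnatEquivNat.symm,
    e.extendDomain_apply_not_subtype _ (lt_irrefl 0), e.extendDomain_apply_image _⟩

theorem exists_perm_getD_eq {l l' : List ℕ} (h : l.Perm l') :
    ∃ e : Equiv.Perm ℕ, ∀ c, l.getD c 0 = l'.getD (e c) 0 := by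
  induction h with
  | nil => exact ⟨1, fun _ => rfl⟩
  | cons a _ ih =>
    obtain ⟨e, he⟩ := ih
    obtain ⟨e', hzero, hsucc⟩ := exists_perm_succ e
    refine ⟨e', fun c => ?_⟩
    cases c with
    | zero => rw [hzero, List.getD_cons_zero, List.getD_cons_zero]
    | succ c => rw [hsucc, List.getD_cons_succ, List.getD_cons_succ, he]
  | swap a b l =>
    refine ⟨Equiv.swap 0 1, fun c => ?_⟩
    rcases c with - | - | c
    · rfl
    · rfl
    · rw [Equiv.swap_apply_of_ne_of_ne (by omega) (by omega)]
      rfl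
  | trans _ _ ih ih' =>
    obtain ⟨e, he⟩ := ih
    obtain ⟨e', he'⟩ := ih'
    exact ⟨e.trans e', fun c => (he c).trans (he' _)⟩

section SameShape

variable {ι : Type*} [Fintype ι] {f g : ι → ℕ}

theorem sameShape_of_card_eq (e : Equiv.Perm ℕ) (hzero : e 0 = 0)
    (h : ∀ c, #{i | f i = c} = #{i | g i = e c}) : SameShape f g := by
  have hcard (c) : Nonempty ({i // f i = c} ≃ {i // e.symm (g i) = c}) :=
    ⟨Fintype.equivOfCardEq (by
      simp only [Fintype.card_subtype, Equiv.symm_apply_eq]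
      exact h c)⟩
  let π := Equiv.ofFiberEquiv fun c => (hcard c).some
  have hπ (i) : g (π i) = e (f i) :=
    (Equiv.symm_apply_eq e).1 (Equiv.ofFiberEquiv_map (fun c => (hcard c).some) i)
  refine ⟨π, fun i j => ?_, fun i => ?_⟩
  · rw [hπ, hπ, e.apply_eq_iff_eq]
  · rw [hπ, ← e.apply_eq_iff_eq, hzero]

theorem SameShape.card_eq (h : SameShape f g) (b : ℕ) :
    #{i | f i ≠ 0 ∧ #{j | f j = f i} = b} = #{i | g i ≠ 0 ∧ #{j | g j = g i} = b} := by
  obtain ⟨π, hπ, hzero⟩ := h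
  have hfiber (i) : #{j | f j = f i} = #{j | g j = g (π i)} :=
    Finset.card_equiv π fun j => by
      simp only [Finset.mem_filter, Finset.mem_univ, true_and, hπ]
  refine Finset.card_equiv π fun i => ?_
  simp only [Finset.mem_filter, Finset.mem_univ, true_and, hfiber, Ne, hzero]

end SameShape

section BlockLevel

variable {n d d' : ℕ} {l l' : List ℕ}

theorem card_blockLevel_eq (hn : d + l.sum = n) (c : ℕ) :
    #{i : Fin n | blockLevel d l (i + 1) = c} = (d :: l).getD c 0 := by
  rcases c with - | j
  · exact card_blockLevel_eq_zero hn
  rw [List.getD_cons_succ]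
  rcases lt_or_ge j l.length with hj | hj
  · rw [card_blockLevel_eq_succ hn hj, List.getD_eq_getElem _ _ hj]
  · rw [List.getD_eq_default _ _ hj, Finset.card_eq_zero, Finset.filter_eq_empty_iff]
    intro i _ h
    have := blockLevel_le_length d l (i + 1)
    omega

theorem exists_blockLevel_eq_zero_iff (hn : d + l.sum = n) :
    (∃ i : Fin n, blockLevel d l (i + 1) = 0) ↔ d ≠ 0 := by
  rw [← Nat.pos_iff_ne_zero]
  conv_rhs => rw [← card_blockLevel_eq_zero hn]
  rw [Finset.card_pos, Finset.filter_nonempty_iff]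
  simp only [Finset.mem_univ, true_and]

theorem exists_odd_card_blockLevel_iff (hn : d + l.sum = n) :
    (∃ i : Fin n, Odd #{j : Fin n | blockLevel d l (j + 1) = blockLevel d l (i + 1)}) ↔
      ∃ a ∈ d :: l, Odd a := by
  simp only [card_blockLevel_eq hn]
  constructor
  · rintro ⟨i, hi⟩
    have hlt := Nat.lt_succ_of_le (blockLevel_le_length d l (i + 1))
    rw [List.getD_eq_getElem _ _ hlt] at hi
    exact ⟨_, List.getElem_mem _, hi⟩
  · rintro ⟨a, ha, hodd⟩
    obtain ⟨c, hc, rfl⟩ := List.mem_iff_getElem.1 ha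
    rw [← List.getD_eq_getElem _ 0 hc, ← card_blockLevel_eq hn] at hodd
    obtain ⟨i, hi⟩ := Finset.card_pos.1 hodd.pos
    obtain rfl := (Finset.mem_filter.1 hi).2
    exact ⟨i, card_blockLevel_eq hn _ ▸ hodd⟩

theorem sum_map_ite_eq (l : List ℕ) (b : ℕ) :
    (l.map fun a => if a = b then b else 0).sum = l.count b * b := by
  induction l with
  | nil => simp
  | cons a l ih =>
    rw [List.map_cons, List.sum_cons, ih, List.count_cons]
    by_cases h : a = b <;> simp [h, add_mul, add_comm]

theorem card_blockLevel_card_eq (hn : d + l.sum = n) (b : ℕ) :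
    #{i : Fin n | blockLevel d l (i + 1) ≠ 0 ∧
      #{j : Fin n | blockLevel d l (j + 1) = blockLevel d l (i + 1)} = b} = l.count b * b := by
  set T : Finset (Fin n) := {i | blockLevel d l (i + 1) ≠ 0 ∧
    #{j : Fin n | blockLevel d l (j + 1) = blockLevel d l (i + 1)} = b} with hT
  have hmaps : ∀ i ∈ T, blockLevel d l (i + 1) - 1 ∈ Finset.range l.length := fun i hi => by
    have := (Finset.mem_filter.1 hi).2.1
    have := blockLevel_le_length d l (i + 1)
    rw [Finset.mem_range]
    omega
  rw [Finset.card_eq_sum_card_fiberwise hmaps, Finset.sum_range]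
  have hfiber (j : Fin l.length) :
      #{i ∈ T | blockLevel d l (i.1 + 1) - 1 = j} = if l[j.1] = b then b else 0 := by
    rw [hT, Finset.filter_filter]
    split_ifs with hb
    · refine (congrArg _ (Finset.filter_congr fun i _ => ?_)).trans
        ((card_blockLevel_eq_succ hn j.2).trans hb)
      refine ⟨fun h => by omega, fun h => ?_⟩
      rw [h, card_blockLevel_eq_succ hn j.2]
      exact ⟨⟨Nat.succ_ne_zero _, hb⟩, Nat.add_sub_cancel _ _⟩
    · refine Finset.card_eq_zero.2 (Finset.filter_eq_empty_iff.2 ?_)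
      rintro i - ⟨⟨hne, hcard⟩, hj⟩
      rw [show blockLevel d l (i + 1) = j + 1 by omega, card_blockLevel_eq_succ hn j.2] at hcard
      exact hb hcard
  rw [Finset.sum_congr rfl fun j _ => hfiber j,
    Fin.sum_univ_fun_getElem l fun a => if a = b then b else 0]
  exact sum_map_ite_eq l b

theorem sameShape_blockLevel_iff (hn : d + l.sum = n) (hn' : d' + l'.sum = n)
    (hpos : ∀ a ∈ l, 0 < a) (hpos' : ∀ a ∈ l', 0 < a) :
    SameShape (fun i : Fin n => blockLevel d l (i + 1))
      (fun i : Fin n => blockLevel d' l' (i + 1)) ↔ l.Perm l' := by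
  constructor
  · refine fun h => List.perm_iff_count.2 fun b => ?_
    rcases Nat.eq_zero_or_pos b with rfl | hb
    · rw [List.count_eq_zero_of_not_mem fun h => (hpos _ h).false,
        List.count_eq_zero_of_not_mem fun h => (hpos' _ h).false]
    · have := h.card_eq b
      rw [card_blockLevel_card_eq hn, card_blockLevel_card_eq hn'] at this
      exact Nat.eq_of_mul_eq_mul_right hb this
  · intro h
    obtain rfl : d = d' := by
      have := h.sum_eq
      omega
    obtain ⟨e, he⟩ := exists_perm_getD_eq h
    obtain ⟨e', hzero, hsucc⟩ := exists_perm_succ e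
    refine sameShape_of_card_eq e' hzero fun c => ?_
    rw [card_blockLevel_eq hn, card_blockLevel_eq hn']
    cases c with
    | zero => rw [hzero, List.getD_cons_zero, List.getD_cons_zero]
    | succ c => rw [hsucc, List.getD_cons_succ, List.getD_cons_succ, he]

end BlockLevel

/-! ### The vectors of the labels -/

namespace DComp

variable {n : ℕ} {κ ν : DComp n}

/-- The number of the component that contains `x`, counted from `1`. -/
def level (κ : DComp n) : ℕ → ℕ := blockLevel κ.offset κ.components

theorem level_eq_zero_iff {x : ℕ} (hx : x ≤ n) : κ.level x = 0 ↔ x ≤ κ.offset :=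
  blockLevel_eq_zero_iff (hx.trans κ.offset_add_sum.ge)

open Classical in
/-- A vector in the face of `κ`: its coordinates are the levels of `1, …, n`, except that the first
one is negated on `C_n'`. -/
noncomputable def vec (κ : DComp n) : OddVec n :=
  ofNat fun x => if κ.InFullPrime ∧ x = 1 then -(κ.level x : ℤ) else κ.level x

theorem absCoord_vec (κ : DComp n) (i : Fin n) : absCoord κ.vec i = κ.level (i + 1) := by
  rw [absCoord, vec, ofNat_coord]
  split_ifs
  · rw [Int.natAbs_neg, Int.natAbs_natCast]
  · rw [Int.natAbs_natCast]

theorem noIsolatedZero_absCoord_vec (κ : DComp n) : NoIsolatedZero (absCoord κ.vec) := by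
  intro i hi
  rw [absCoord_vec] at hi
  have hcard : #{j : Fin n | κ.level (j + 1) = 0} = κ.offset :=
    card_blockLevel_eq_zero κ.offset_add_sum
  have hpos : 0 < #{j : Fin n | κ.level (j + 1) = 0} :=
    Finset.card_pos.2 ⟨i, Finset.mem_filter.2 ⟨Finset.mem_univ i, hi⟩⟩
  obtain ⟨j, hj, hne⟩ := Finset.exists_mem_ne
    (lt_of_le_of_ne hpos (hcard.trans_ne κ.offset_ne_one).symm) i
  exact ⟨j, hne, (κ.absCoord_vec j).trans (Finset.mem_filter.1 hj).2⟩

theorem exists_absCoord_vec_eq_zero_iff : (∃ i, absCoord κ.vec i = 0) ↔ κ.offset ≠ 0 := by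
  simp only [absCoord_vec]
  exact exists_blockLevel_eq_zero_iff κ.offset_add_sum

theorem exists_odd_card_absCoord_vec_iff :
    (∃ i, Odd #{j | absCoord κ.vec j = absCoord κ.vec i}) ↔
      ∃ a ∈ κ.offset :: κ.components, Odd a := by
  simp only [absCoord_vec]
  exact exists_odd_card_blockLevel_iff κ.offset_add_sum

theorem sameShape_absCoord_vec_iff :
    SameShape (absCoord κ.vec) (absCoord ν.vec) ↔ κ.components.Perm ν.components := by
  rw [funext κ.absCoord_vec, funext ν.absCoord_vec]
  exact sameShape_blockLevel_iff κ.offset_add_sum ν.offset_add_sum κ.components_pos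
    ν.components_pos

theorem signProd_vec (hzero : κ.offset = 0) (h : ¬ κ.InFullPrime) : signProd κ.vec.1 = 1 := by
  refine Finset.prod_eq_one fun i _ => Int.sign_eq_one_of_pos ?_
  have hlevel := (κ.level_eq_zero_iff (x := i + 1) i.2).not.2
    (by rw [hzero]; omega)
  rw [vec, ofNat_coord, if_neg fun h' => h h'.1]
  omega

variable [hn : n.AtLeastTwo]

theorem InFullPrime.signProd_vec (h : κ.InFullPrime) : signProd κ.vec.1 = -1 := by
  have hn := hn.prop
  have hlevel (i : Fin n) : 0 < κ.level (i + 1) :=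
    Nat.pos_of_ne_zero ((level_eq_zero_iff i.2).not.2 (by rw [h.offset_eq_zero]; omega))
  rw [signProd, Finset.prod_eq_single (⟨0, by omega⟩ : Fin n) (fun i _ hi => ?_) (by simp), vec,
    ofNat_coord, if_pos ⟨h, rfl⟩]
  · have := hlevel ⟨0, by omega⟩
    exact Int.sign_eq_neg_one_of_neg (by omega)
  · have := hlevel i
    rw [vec, ofNat_coord, if_neg fun h' => hi (Fin.ext (Nat.succ_injective h'.2))]
    exact Int.sign_eq_one_of_pos (by omega)

theorem simpleRoot_vec (h : ¬ κ.InFullPrime) (i : Fin n) :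
    (dSystem n).simpleRoot i κ.vec =
      if (i : ℕ) = 0 then (κ.level 1 : ℤ) + κ.level 2 else κ.level (i + 1) - κ.level i := by
  refine (coordSub_ofNat _ i).trans ?_
  simp only [h, false_and, if_false]

theorem InFullPrime.simpleRoot_vec (h : κ.InFullPrime) (i : Fin n) :
    (dSystem n).simpleRoot i κ.vec =
      if (i : ℕ) = 1 then (κ.level 1 : ℤ) + κ.level 2 else
        if (i : ℕ) = 0 then (κ.level 2 : ℤ) - κ.level 1 else κ.level (i + 1) - κ.level i := by
  refine (coordSub_ofNat _ i).trans ?_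
  rcases eq_or_ne (i : ℕ) 0 with h0 | h0
  · simp [h, h0, sub_eq_neg_add]
  rcases eq_or_ne (i : ℕ) 1 with h1 | h1
  · simp [h, h1, add_comm]
  · simp [h, h0, h1]

theorem level_two_eq_zero_iff : κ.level 2 = 0 ↔ κ.offset ≠ 0 := by
  have hone := κ.offset_ne_one
  rw [level_eq_zero_iff hn.prop]
  omega

theorem isDominant_vec (κ : DComp n) : (dSystem n).IsDominant κ.vec := by
  have hmono (x : ℕ) : κ.level x ≤ κ.level (x + 1) := blockLevel_mono _ _ (Nat.le_succ x)
  refine SimpleSystem.isDominant_iff_simpleRoot.2 fun i => ?_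
  have hi := hmono i
  by_cases h : κ.InFullPrime
  · have hone : κ.level 1 ≤ κ.level 2 := hmono 1
    rw [h.simpleRoot_vec]
    split_ifs <;> omega
  · rw [simpleRoot_vec h]
    split_ifs <;> omega

theorem simpleRoot_vec_eq_zero_iff {i : Fin n} :
    (dSystem n).simpleRoot i κ.vec = 0 ↔ i ∉ κ.indexSet := by
  have hstarts (x : ℕ) : (κ.level (x + 1) : ℤ) - κ.level x = 0 ↔ x ∉ κ.starts := by
    rw [sub_eq_zero, Nat.cast_inj]
    exact blockLevel_succ_eq_iff
  have hle : κ.level 1 ≤ κ.level 2 := blockLevel_mono _ _ one_le_two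
  have hzero : (κ.level 1 : ℤ) + κ.level 2 = 0 ↔ κ.offset ≠ 0 := by
    rw [← level_two_eq_zero_iff]
    omega
  by_cases h : κ.InFullPrime
  · rw [h.simpleRoot_vec, h.mem_indexSet_iff]
    split_ifs with h1 h0
    · simp [hzero, h.offset_eq_zero, h1]
    · simpa [h0] using (hstarts 1).2 h.one_notMem_starts
    · simp [hstarts, h0, h1]
  · rw [simpleRoot_vec h, mem_indexSet_iff h]
    split_ifs with h0
    · rw [hzero, h0, zero_mem_starts_iff]
    · exact hstarts i

theorem flatSetoid_faceVec_vec (κ : DComp n) :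
    (dSystem n).flatSetoid ((dSystem n).faceVec κ.indexSetᶜ) κ.vec := by
  refine ⟨1, ?_⟩
  rw [one_smul]
  refine SimpleSystem.zeroSet_eq_of_simpleZeros_eq ((dSystem n).isDominant_faceVec _)
    κ.isDominant_vec ?_
  rw [SimpleSystem.simpleZeros_faceVec]
  ext i
  exact simpleRoot_vec_eq_zero_iff.symm

theorem inFull_or_inFullPrime_of_even (hzero : κ.offset = 0)
    (heven : ∀ a ∈ κ.components, Even a) : κ.InFull ∨ κ.InFullPrime := by
  have := hn.prop
  cases κ with
  | below m hm c =>
    simp only [offset, components, c.blocks_sum] at hzero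
    omega
  | one c hc => exact absurd (heven 1 (List.mem_of_mem_head? hc)) Nat.not_even_one
  | full => exact Or.inl trivial
  | fullPrime => exact Or.inr trivial

theorem signProd_vec_eq_iff (hκ : κ.offset = 0) (hν : ν.offset = 0) :
    signProd κ.vec.1 = signProd ν.vec.1 ↔ (κ.InFullPrime ↔ ν.InFullPrime) := by
  by_cases hκ' : κ.InFullPrime <;> by_cases hν' : ν.InFullPrime <;>
    simp [hκ', hν', InFullPrime.signProd_vec, signProd_vec, hκ, hν]

theorem equivalent_iff_of_even (hperm : κ.components.Perm ν.components) (hκ : κ.offset = 0)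
    (hν : ν.offset = 0) (heven : ∀ a ∈ κ.components, Even a) :
    κ.Equivalent ν ↔ (κ.InFullPrime ↔ ν.InFullPrime) := by
  have hfullκ := inFull_or_inFullPrime_of_even hκ heven
  have hfullν := inFull_or_inFullPrime_of_even hν fun a ha => heven a (hperm.mem_iff.2 ha)
  have hκ' := InFull.not_inFullPrime (κ := κ)
  have hν' := InFull.not_inFullPrime (κ := ν)
  rw [Equivalent]
  tauto

theorem equivalent_iff :
    κ.Equivalent ν ↔ κ.components.Perm ν.components ∧
      (κ.offset ≠ 0 ∨ (∃ a ∈ κ.offset :: κ.components, Odd a) ∨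
        signProd κ.vec.1 = signProd ν.vec.1) := by
  have hodd : (κ.offset ≠ 0 ∨ ∃ a ∈ κ.offset :: κ.components, Odd a) ↔
      ¬ (κ.offset = 0 ∧ ∀ a ∈ κ.components, Even a) := by
    by_cases hzero : κ.offset = 0 <;> simp [hzero]
  rw [← or_assoc, hodd, ← imp_iff_not_or]
  by_cases hperm : κ.components.Perm ν.components
  swap
  · exact iff_of_false (fun h => hperm h.1) fun h => hperm h.1
  rw [and_iff_right hperm]
  by_cases heven : κ.offset = 0 ∧ ∀ a ∈ κ.components, Even a
  · have hν : ν.offset = 0 := by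
      have := κ.offset_add_sum
      have := ν.offset_add_sum
      have := hperm.sum_eq
      omega
    rw [equivalent_iff_of_even hperm heven.1 hν heven.2, signProd_vec_eq_iff heven.1 hν,
      imp_iff_right heven]
  · exact iff_of_true ⟨hperm, fun h => heven ⟨h.1.offset_eq_zero, h.2.2⟩,
      fun h => heven ⟨h.1.offset_eq_zero, h.2.2⟩⟩ fun h => absurd h heven

theorem flatSetoid_faceVec_iff :
    (dSystem n).flatSetoid ((dSystem n).faceVec κ.indexSetᶜ) ((dSystem n).faceVec ν.indexSetᶜ) ↔
      κ.Equivalent ν := by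
  have hvec : (dSystem n).flatSetoid ((dSystem n).faceVec κ.indexSetᶜ)
      ((dSystem n).faceVec ν.indexSetᶜ) ↔ (dSystem n).flatSetoid κ.vec ν.vec :=
    (Quotient.eq.symm.trans (by
      rw [Quotient.sound κ.flatSetoid_faceVec_vec, Quotient.sound ν.flatSetoid_faceVec_vec])).trans
      Quotient.eq
  rw [hvec, flatSetoid_iff κ.noIsolatedZero_absCoord_vec ν.noIsolatedZero_absCoord_vec,
    sameShape_absCoord_vec_iff, exists_absCoord_vec_eq_zero_iff, exists_odd_card_absCoord_vec_iff,
    equivalent_iff]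

theorem exists_indexSet_eq_of_one_mem {T : Set (Fin n)} (hzero : 0 ∉ Fin.val '' T)
    (hone : 1 ∈ Fin.val '' T) : ∃ κ : DComp n, κ.indexSet = T := by
  have hn := hn.prop
  have hfinite := Set.toFinite (insert 0 (Fin.val '' T \ {1}))
  obtain ⟨l, hpos, hsum, hl⟩ := exists_blockStarts_eq (n := n) hfinite.toFinset fun x hx => by
    rcases hfinite.mem_toFinset.1 hx with rfl | ⟨⟨i, -, rfl⟩, -⟩
    · omega
    · exact i.2
  rw [hfinite.coe_toFinset] at hl
  have hsum : l.sum = n := by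
    obtain ⟨j, -, h⟩ := hl.superset (Set.mem_insert _ _)
    omega
  rw [hsum, Nat.sub_self] at hl
  obtain ⟨κ, hκ, rfl⟩ := exists_inFullPrime_components_eq hpos hsum hn (by simp [hl])
  refine ⟨κ, Set.ext fun i => ?_⟩
  rw [hκ.mem_indexSet_iff, starts, hκ.offset_eq_zero, hl, ← Fin.val_injective.mem_set_image,
    Set.mem_insert_iff, Set.mem_sdiff, Set.mem_singleton_iff]
  rcases eq_or_ne (i : ℕ) 0 with hi | hi
  · simp only [hi, hzero]
    simp
  · rcases eq_or_ne (i : ℕ) 1 with hi' | hi'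
    · simp only [hi', hone, true_or]
    · simp only [hi, hi', false_or, ne_eq, not_false_eq_true, true_and, and_true]

theorem exists_indexSet_eq_of_one_mem_imp {T : Set (Fin n)}
    (h : 1 ∈ Fin.val '' T → 0 ∈ Fin.val '' T) : ∃ κ : DComp n, κ.indexSet = T := by
  have hn := hn.prop
  have hfinite := Set.toFinite (Fin.val '' T)
  obtain ⟨l, hpos, hsum, hl⟩ := exists_blockStarts_eq (n := n) hfinite.toFinset fun x hx => by
    obtain ⟨i, -, rfl⟩ := hfinite.mem_toFinset.1 hx
    exact i.2
  rw [hfinite.coe_toFinset] at hl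
  have hone : n - l.sum ≠ 1 := by
    intro hone
    have hlength : 0 < l.length := List.length_pos_iff.2 fun hnil => by
      rw [hnil, List.sum_nil] at hone
      omega
    rw [← hl, hone] at h
    obtain ⟨j, -, hj⟩ := h ⟨0, hlength, rfl⟩
    omega
  obtain ⟨κ, hκ, rfl⟩ := exists_components_eq hpos hsum (by omega) hone
  refine ⟨κ, Set.ext fun i => ?_⟩
  rw [mem_indexSet_iff hκ, starts, offset, hl, Fin.val_injective.mem_set_image]

theorem exists_indexSet_eq (T : Set (Fin n)) : ∃ κ : DComp n, κ.indexSet = T := by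
  by_cases h : 1 ∈ Fin.val '' T → 0 ∈ Fin.val '' T
  · exact exists_indexSet_eq_of_one_mem_imp h
  · obtain ⟨hone, hzero⟩ := Classical.not_imp.1 h
    exact exists_indexSet_eq_of_one_mem hzero hone

end DComp

theorem basisB_eq_parabolicElt (k : Type*) [Field k] {n : ℕ} [n.AtLeastTwo] (κ : DComp n) :
    basisB k κ = (dSystem n).parabolicElt k κ.indexSetᶜ := by
  refine Subtype.ext ?_
  change cosetSum k (genSet n) (genSet n \ gen n '' κ.indexSet) =
    cosetSum k (genSet n) (gen n '' κ.indexSetᶜ)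
  rw [genSet, ← Set.image_univ, ← Set.image_sdiff gen_injective, Set.compl_eq_univ_sdiff]

theorem mainTheorem2 (k : Type*) [Field k] [CharZero k] (n : ℕ) [n.AtLeastTwo] :
    (Ring.jacobson (SigmaD k n)).restrictScalars k =
      Submodule.span k
        {x : SigmaD k n | ∃ κ ν : DComp n, κ.Equivalent ν ∧ x = basisB k κ - basisB k ν} := by
  refine ((dSystem n).jacobson_descentAlgebra k).trans (congrArg _ (Set.ext fun x => ?_))
  constructor
  · rintro ⟨K, J, h, rfl⟩
    obtain ⟨κ, hκ⟩ := DComp.exists_indexSet_eq Kᶜ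
    obtain ⟨ν, hν⟩ := DComp.exists_indexSet_eq Jᶜ
    obtain rfl : K = κ.indexSetᶜ := by rw [hκ, compl_compl]
    obtain rfl : J = ν.indexSetᶜ := by rw [hν, compl_compl]
    exact ⟨κ, ν, DComp.flatSetoid_faceVec_iff.1 h,
      congrArg₂ _ (basisB_eq_parabolicElt k κ).symm (basisB_eq_parabolicElt k ν).symm⟩
  · rintro ⟨κ, ν, h, rfl⟩
    exact ⟨_, _, DComp.flatSetoid_faceVec_iff.2 h,
      congrArg₂ _ (basisB_eq_parabolicElt k κ) (basisB_eq_parabolicElt k ν)⟩
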